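/- Let $q$ be a power of a prime, $n$ an odd divisor of $q^2-1$ with $q+1<n\le q^2-1$, and let $2\le \mu=2t\le\lfloor n/(q+1)\rfloor$. Let $(\beta,\beta^q)$ be a normal basis of $\mathbf F_{q^2}/\mathbf F_q$. *Conventions.* The qudits of the stream are indexed by $\mathbf Z$. $P_\infty$ is the group generated by the single-site operators $X(a)|x\rangle=|x+a\rangle$, $Z(b)|x\rangle=e^{2\pi i\,\mathrm{tr}(bx)/p}|x\rangle$ ($a,b\in\mathbf F_q$, $p$ the characteristic, $\mathrm{tr}$ the absolute trace); $P_t\le P_\infty$ is its subgroup on the qudits $0,\dots,(t+1)n+m-1$, with center $Z_t$. A convolutional stabilizer code with parameters $[(n,k,m)]_q$ ($k\le n$) is given by an abelian subgroup $S_0\le P_0$ such that, with $S_t=\langle S_{t-1},\,I^{\otimes tn}\otimes S_0\rangle$: (S1) $I^{\otimes tn}\otimes M$ commutes with $N$ for all $M,N\in S_0$ and $t\geq 1$; (S2) $S_tZ_t/Z_t$ is an $\mathbf F_q$-vector space of dimension $(t+1)(n-k)$ for all $t\ge0$; (S3) $S_t\cap Z_t=\{1\}$ for all $t\ge 0$.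 Its stabilizer $S$ is generated by the shifts of $S_0$ by all multiples of $n$ (in both directions), and the code is the $+1$-eigenspace of $S$. The weight of an element of $P_\infty$ is its number of tensor factors that are not scalar. The code has free distance $d_f=\min\{\mathrm{wt}(e)\mid e\in C_{P_\infty}(S)\setminus Z(P_\infty)S\}$, and it is pure if $S$ contains no element $\neq 1$ of weight less than $d_f$. Let $\tau$ map $\omega^c\bigotimes_i X(a_i)Z(b_i)$, with $\omega=e^{2\pi i/p}$, to the sequence $(\beta a_i+\beta^q b_i)_{i\in\mathbf Z}$, and let $\sigma$ map $u\in\mathbf F_{q^2}[D]^n$ to the coefficient sequence of $\sum_{i=0}^{n-1}D^iu_i(D^n)$. The code is $\mathbf F_{q^2}$-linear if $\tau(S_0)$ is closed under multiplication by $\mathbf F_{q^2}$, and it has degree $\delta$ if $C=\sigma^{-1}(\tau(S))$ is an $(n,(n-k)/2,\delta)_{q^2}$ convolutional code, i.e. $C$ is generated by the rows of a right-invertible $\frac{n-k}2\times n$ polynomial matrix whose row degrees add up to $\delta$, the largest degree of a full-size minor. Then the parameters are written $[(n,k,m;\delta,d_f)]_q$. *Theorem.* Primitive $n$th roots of unity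 exist in $\mathbf F_{q^2}$, and for each of them, $\alpha$, there is a pure $\mathbf F_{q^2}$-linear convolutional stabilizer code with parameters $[(n,n-\mu,n;\mu/2,\mu+1)]_q$ for which $C$ is the Reed–Solomon convolutional code generated by $H_0+H_1D$, where $H_0=(\alpha^{(2j-1)i})$ and $H_1=(\alpha^{-(2j-1)i})$, $1\le j\le t$, $0\le i<n$. Its parameters attain the Singleton bound $$d_f\le\frac{n-k}{2}\left(\left\lfloor\frac{2\delta}{n+k}\right\rfloor+1\right)+\delta+1$$ with equality, and it is optimal: every pure $\mathbf F_{q^2}$-linear code with parameters $[(n,n-\mu,m;\mu/2,d)]_q$, for any $m\ge 0$, has $d\le\mu+1$. -/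

import Mathlib

noncomputable section

open Polynomial

namespace QConv

/-! ## The Pauli group of a stream of qudits

The qudits of the stream are indexed by `ℤ`; step `t` of the stream starts at qudit `t * n`.
A basis state `|x⟩` is a configuration `x : ℤ → F`, and a state is a formal superposition
`∑ ψ x |x⟩`, given by its amplitudes `ψ`. On finitely many sites this is `(ℂ^q)^{⊗ N}`. -/

/-- States of a bi-infinite stream of `q`-ary quantum digits. -/
abbrev State (F : Type*) : Type _ := (ℤ → F) → ℂ

/-- The group of invertible linear operators on states. -/
abbrev Op (F : Type*) : Type _ := State F ≃ₗ[ℂ] State F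

variable {F : Type*} [Field F]

/-- `exp (2 π i tr(x) / p)`, with `p` the characteristic of `F` and `tr` the absolute trace. -/
def chi (x : F) : ℂ :=
  letI : Algebra (ZMod (ringChar F)) F := ZMod.algebra F (ringChar F)
  Complex.exp (2 * Real.pi * Complex.I *
    ((Algebra.trace (ZMod (ringChar F)) F x).val : ℂ) / (ringChar F : ℂ))

theorem chi_ne_zero (x : F) : chi x ≠ 0 := Complex.exp_ne_zero _

/-- `⨂ X(a i)`, the operator `|x⟩ ↦ |x + a⟩`. -/
def pauliX (a : ℤ →₀ F) : Op F :=
  LinearEquiv.funCongrLeft ℂ ℂ (Equiv.subRight (⇑a : ℤ → F))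

/-- `⨂ Z(b i)`, the operator `|x⟩ ↦ exp (2 π i tr(∑ b i * x i) / p) |x⟩`. -/
def pauliZ (b : ℤ →₀ F) : Op F :=
  LinearEquiv.piCongrRight fun x : ℤ → F =>
    LinearEquiv.smulOfNeZero ℂ ℂ (chi (b.sum fun i y => y * x i)) (chi_ne_zero _)

/-- The Pauli group on the sites in `I`: the group generated by the tensor products of the error
basis elements `X(a)`, `Z(b)`, placed at sites in `I` (with identities at all other sites). -/
def pauliGroup (F : Type*) [Field F] (I : Set ℤ) : Subgroup (Op F) :=
  Subgroup.closure
    {g | ∃ i ∈ I, ∃ y : F, g = pauliX (Finsupp.single i y) ∨ g = pauliZ (Finsupp.single i y)}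

/-- `P_t`, the Pauli group on the `(t + 1) * n + m` qudits `0, 1, …, (t + 1) * n + m - 1`. The
inclusion `M ↦ M ⊗ I ⊗ ⋯ ⊗ I` of `P_i` in `P_j` is the inclusion of subgroups. -/
def pauliStep (F : Type*) [Field F] (n m t : ℕ) : Subgroup (Op F) :=
  pauliGroup F (Set.Ico (0 : ℤ) (((t + 1) * n + m : ℕ) : ℤ))

/-- `P_∞`: all tensor products of Pauli operators with finitely many non-identity factors. -/
def pauliInf (F : Type*) [Field F] : Subgroup (Op F) := pauliGroup F Set.univ

/-- The center of a subgroup, as a subgroup of the ambient group. -/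
def centerOf {G : Type*} [Group G] (P : Subgroup G) : Subgroup G :=
  P ⊓ Subgroup.centralizer (P : Set G)

/-- `g = ω ^ c • ⨂ X(a i) Z(b i)` for some `c`, with `ω = exp (2 π i / p)`. Each element of `P_∞`
has exactly one symbol `(a, b)`. -/
def IsSymbol (g : Op F) (a b : ℤ →₀ F) : Prop :=
  ∃ c : ℕ, ∀ ψ : State F,
    g ψ = Complex.exp (2 * Real.pi * Complex.I * (c : ℂ) / (ringChar F : ℂ)) •
      pauliX a (pauliZ b ψ)

/-- `g` is a Pauli operator with exactly `w` tensor factors that are not (a scalar multiple of)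
the identity. -/
def HasWeight (g : Op F) (w : ℕ) : Prop :=
  ∃ a b : ℤ →₀ F, IsSymbol g a b ∧ Set.ncard {i : ℤ | a i ≠ 0 ∨ b i ≠ 0} = w

/-- The translation `|x⟩ ↦ |x (· - l)⟩` of the stream by `l` places to the right. -/
def translate (F : Type*) [Field F] (l : ℤ) : Op F :=
  LinearEquiv.funCongrLeft ℂ ℂ ((Equiv.addRight l).symm.arrowCongr (Equiv.refl F))

/-- The shift of an operator by `l` places to the right; for `0 ≤ l` and `M` acting on the qudits
`0, 1, …` this is `M ↦ I^{⊗ l} ⊗ M`. -/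
def shift (F : Type*) [Field F] (l : ℤ) : Op F →* Op F :=
  (MulAut.conj (translate F l)).toMonoidHom

/-- `S_t = ⟨N ⊗ I^{⊗ n}, I^{⊗ t n} ⊗ M | N ∈ S_{t-1}, M ∈ S_0⟩`. -/
def stabStep (n : ℕ) (S₀ : Subgroup (Op F)) : ℕ → Subgroup (Op F)
  | 0 => S₀
  | t + 1 => stabStep n S₀ t ⊔ S₀.map (shift F (((t + 1) * n : ℕ) : ℤ))

/-- The stabilizer of a convolutional stabilizer code with parameters `[(n, k, m)]_q`: an abelian
subgroup `S₀` of `P_0` that satisfies (S1), (S2), (S3). In `dim_eq`, the quotient `S_t Z_t / Z_t`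
is identified with the set of symbols of the elements of `S_t`. -/
structure ConvStabCode (F : Type*) [Field F] (n k m : ℕ) where
  S₀ : Subgroup (Op F)
  le_pauli : S₀ ≤ pauliStep F n m 0
  abelian : ∀ M ∈ S₀, ∀ N ∈ S₀, M * N = N * M
  k_le : k ≤ n
  shift_comm : ∀ t : ℕ, 0 < t → ∀ M ∈ S₀, ∀ N ∈ S₀,
    shift F ((t * n : ℕ) : ℤ) M * N = N * shift F ((t * n : ℕ) : ℤ) M
  dim_eq : ∀ t : ℕ, ∃ W : Submodule F ((ℤ →₀ F) × (ℤ →₀ F)),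
    (∀ a b, (a, b) ∈ W ↔ ∃ g ∈ stabStep n S₀ t, IsSymbol g a b) ∧
    Module.finrank F W = (t + 1) * (n - k)
  center_trivial : ∀ t : ℕ, stabStep n S₀ t ⊓ centerOf (pauliStep F n m t) = ⊥

/-! ## Classical convolutional codes over `K` -/

section Classical

variable {K : Type*} [Field K]

/-- The code `{u(D) G(D)}` generated by the rows of a polynomial matrix. -/
def rowCode {r n : ℕ} (G : Matrix (Fin r) (Fin n) K[X]) : Set (Fin n → K[X]) :=
  Set.range fun u : Fin r → K[X] => Matrix.vecMul u G

/-- `C` is an `(n, r, δ)` convolutional code: it is generated by a right-invertible `r × n`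
polynomial matrix whose row degrees `ν i` add up to `δ`, the largest degree of an `r`-minor. -/
def IsConvCode {n : ℕ} (C : Set (Fin n → K[X])) (r δ : ℕ) : Prop :=
  ∃ G : Matrix (Fin r) (Fin n) K[X],
    (∃ R : Matrix (Fin n) (Fin r) K[X], G * R = 1) ∧
    C = rowCode G ∧
    (∑ i, Finset.univ.sup fun j => (G i j).natDegree) = δ ∧
    IsGreatest {e : WithBot ℕ | ∃ c : Fin r ↪o Fin n, (G.submatrix id c).det.degree = e}
      (δ : WithBot ℕ)

/-- `σ`: the interleaved coefficient sequence of `u`, i.e. the coefficient sequence of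
`∑ i, D^i u_i(D^n)`, extended by zero to negative positions. -/
def interleave {n : ℕ} (u : Fin n → K[X]) : ℤ → K := fun N =>
  if 0 ≤ N then (∑ i : Fin n, X ^ (i : ℕ) * expand K n (u i)).coeff N.toNat else 0

/-- Piret's Reed–Solomon generator matrix `H_0 + H_1 D`, where `H_0` has the rows
`(α^{(2j-1) i})_{0 ≤ i < n}` and `H_1` has the rows `(α^{-(2j-1) i})_{0 ≤ i < n}`, `1 ≤ j ≤ t`. -/
def piretMatrix (α : K) (n t : ℕ) : Matrix (Fin t) (Fin n) K[X] :=
  Matrix.of fun j i =>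
    C (α ^ ((2 * (j : ℕ) + 1) * (i : ℕ))) + C (α⁻¹ ^ ((2 * (j : ℕ) + 1) * (i : ℕ))) * X

/-- `v = τ(g)`: the sequence `v i = β a i + β^q b i`, where `(a, b)` is the symbol of `g` and `q`
is the number of elements of `F`. -/
def IsTau [Algebra F K] (β : K) (g : Op F) (v : ℤ → K) : Prop :=
  ∃ a b : ℤ →₀ F, IsSymbol g a b ∧
    ∀ i, v i = β * algebraMap F K (a i) + β ^ Nat.card F * algebraMap F K (b i)

end Classical

namespace ConvStabCode

variable {n k m : ℕ} (Q : ConvStabCode F n k m)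

/-- The stabilizer `S`, generated by all shifts of elements of `S_0` by multiples of `n`. -/
def stabilizer : Subgroup (Op F) := ⨆ l : ℤ, Q.S₀.map (shift F (l * n))

/-- The quantum code itself: the `+1`-eigenspace of the stabilizer. -/
def codeSpace : Submodule ℂ (State F) where
  carrier := {ψ | ∀ g ∈ Q.stabilizer, g ψ = ψ}
  add_mem' := fun ha hb g hg => by rw [map_add, ha g hg, hb g hg]
  zero_mem' := fun g _ => map_zero g
  smul_mem' := fun c _ ha g hg => by rw [map_smul, ha g hg]

/-- The code has free distance `d = min {wt(e) | e ∈ C_{P_∞}(S) \ Z(P_∞) S}`. -/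
def HasFreeDistance (d : ℕ) : Prop :=
  IsLeast {w : ℕ | ∃ e ∈ pauliInf F, e ∈ Subgroup.centralizer (Q.stabilizer : Set (Op F)) ∧
    e ∉ centerOf (pauliInf F) ⊔ Q.stabilizer ∧ HasWeight e w} d

/-- A code of free distance `d` is pure if its stabilizer contains no error of weight less
than `d`. -/
def IsPure (d : ℕ) : Prop :=
  ∀ g ∈ Q.stabilizer, g ≠ 1 → ∀ w, HasWeight g w → d ≤ w

variable {K : Type*} [Field K] [Algebra F K] (β : K)

/-- The code is `F_{q²}`-linear: `τ(S_0)` is closed under multiplication by scalars in `K`. -/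
def IsLinear : Prop :=
  ∀ g ∈ Q.S₀, ∀ v : ℤ → K, IsTau β g v → ∀ x : K, ∃ h ∈ Q.S₀, IsTau β h (x • v)

/-- The associated classical code `σ⁻¹ τ(S)`. -/
def classicalCode : Set (Fin n → K[X]) :=
  {u | ∃ g ∈ Q.stabilizer, IsTau β g (interleave u)}

/-- The degree of the quantum code is `δ`: the associated classical code is an
`(n, (n - k) / 2, δ)` convolutional code. -/
def HasDegree (δ : ℕ) : Prop :=
  ∃ r : ℕ, 2 * r + k = n ∧ IsConvCode (Q.classicalCode β) r δ

/-- `Q` is a pure `F_{q²}-`linear code with parameters `[(n, k, m; δ, d)]_q`. -/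
def IsPureLinear (δ d : ℕ) : Prop :=
  Q.IsLinear β ∧ Q.HasDegree β δ ∧ Q.HasFreeDistance d ∧ Q.IsPure d

end ConvStabCode

/-- The right-hand side of the Singleton bound for pure `[(n, k, m; δ, d)]_q` codes. -/
def singletonBound (n k δ : ℕ) : ℚ :=
  ((n : ℚ) - k) / 2 * ((⌊(2 * δ : ℚ) / ((n : ℚ) + k)⌋ : ℚ) + 1) + δ + 1

end QConv

end

/-! Up to a phase, a Pauli operator is its symbol `(a, b)`: symbols add under multiplication, with
phase `tr(b · a')`, so two operators commute exactly when the trace of the symplectic form of their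
symbols vanishes. Under `τ` this form becomes the skew part of the Hermitian form `h`: the
difference `h - h^q` is `β² - β^(2q)`, which is nonzero, times the symplectic form
(`herm_sub_frobenius`). Hence Hermitian orthogonal sequences give commuting operators, and commuting
with all `K`-multiples of a sequence forces Hermitian orthogonality
(`herm_eq_zero_of_phaseForm_comm`). The problem thus turns into one about the classical code.

Self-orthogonality. The rows of `H₀` and `H₁` are the words `α^(e i)` with `e` odd, `|e| ≤ μ - 1`.
The Hermitian product of two of them is a geometric sum with exponent `e + q e'`, and it vanishes
because `0 < |e + q e'| ≤ (μ - 1)(q + 1) < n` (`not_dvd_rowExponents`).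

Phases. The stabilizer may contain no scalar other than `1`, so the symbols must lift
homomorphically to operators. This is possible once the lifts have order `p`, since then they form
an `F_p`-vector space that maps onto the symbols, and such a map splits (`exists_section`). For odd
`p` the order is automatic; for `p = 2` it follows from self-orthogonality together with the fact
that the coordinates of each code sequence sum to zero (`choose_mul_phaseForm_self`).

Distance. In a nonzero sequence orthogonal to the code, the first nonzero block is orthogonal to
`H₁` and the last to `H₀`, up to conjugation. If they coincide, the block is orthogonal to `2t` rows
with exponents in arithmetic progression, and the Vandermonde argument gives weight at least `2t +
1`; otherwise each of the two has weight at least `t + 1` (`le_card_support_of_orthogonal`). Purity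
follows, as the abelian stabilizer lies in its own centralizer.

Optimality. A word in a single block that is orthogonal to all coefficient rows of a generator
matrix satisfies `r + δ` linear conditions, so it can be chosen of weight at most `r + δ + 1`.
Either it lies outside `Z(P_∞) S` and bounds the free distance, or it lies inside and purity gives
the same bound (`le_of_isPureLinear`). -/

noncomputable section

open Polynomial

namespace QConv

/-! ### Pauli operators as pairs of a phase and a symbol. -/

section Pauli

variable {F : Type*} [Field F]

/-- The pairing of a finitely supported sequence with an arbitrary sequence. -/
def dot (b : ℤ →₀ F) (x : ℤ → F) : F := b.sum fun i y => y * x i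

theorem dot_add_left (b b' : ℤ →₀ F) (x : ℤ → F) : dot (b + b') x = dot b x + dot b' x :=
  Finsupp.sum_add_index' (by simp) (by intros; ring)

theorem dot_zero_left (x : ℤ → F) : dot 0 x = 0 := Finsupp.sum_zero_index

theorem dot_add_right (b : ℤ →₀ F) (x y : ℤ → F) : dot b (x + y) = dot b x + dot b y := by
  simp only [dot, Pi.add_apply, mul_add, Finsupp.sum_add]

theorem dot_zero_right (b : ℤ →₀ F) : dot b 0 = 0 := by
  simp [dot]

theorem dot_neg_right (b : ℤ →₀ F) (x : ℤ → F) : dot b (-x) = -dot b x := by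
  rw [eq_neg_iff_add_eq_zero, ← dot_add_right, neg_add_cancel, dot_zero_right]

theorem dot_sub_right (b : ℤ →₀ F) (x y : ℤ → F) : dot b (x - y) = dot b x - dot b y := by
  rw [sub_eq_add_neg, dot_add_right, dot_neg_right, sub_eq_add_neg]

theorem dot_single_left (i : ℤ) (y : F) (x : ℤ → F) : dot (Finsupp.single i y) x = y * x i :=
  Finsupp.sum_single_index (by simp)

theorem dot_single_right (b : ℤ →₀ F) (i : ℤ) (z : F) :
    dot b (Finsupp.single i z) = b i * z := by
  classical
  rw [dot, Finsupp.sum]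
  by_cases hi : i ∈ b.support
  · rw [Finset.sum_eq_single_of_mem i hi, Finsupp.single_eq_same]
    intro j _ hj
    rw [Finsupp.single_eq_of_ne hj, mul_zero]
  · rw [Finsupp.notMem_support_iff.1 hi, zero_mul]
    refine Finset.sum_eq_zero fun j hj => ?_
    rw [Finsupp.single_eq_of_ne (by rintro rfl; exact hi hj), mul_zero]

/-- The translation of finitely supported sequences by `l` places to the right. -/
def translateSeq (R M : Type*) [Semiring R] [AddCommMonoid M] [Module R M] (l : ℤ) :
    (ℤ →₀ M) ≃ₗ[R] (ℤ →₀ M) :=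
  Finsupp.domLCongr (Equiv.addRight l)

theorem translateSeq_apply {R M : Type*} [Semiring R] [AddCommMonoid M] [Module R M] (l : ℤ)
    (v : ℤ →₀ M) (i : ℤ) : translateSeq R M l v i = v (i - l) := rfl

theorem dot_translateSeq (l : ℤ) (b : ℤ →₀ F) (x : ℤ → F) :
    dot (translateSeq F F l b) x = dot b fun i => x (i + l) := by
  rw [dot, translateSeq, Finsupp.domLCongr_apply, Finsupp.domCongr_apply,
    Finsupp.equivMapDomain_eq_mapDomain, Finsupp.sum_mapDomain_index (by simp) (by intros; ring)]
  rfl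

variable [Finite F]

/-- The characteristic of a finite field is a prime number. -/
theorem fact_prime_ringChar (F : Type*) [Field F] [Finite F] : Fact (ringChar F).Prime :=
  ⟨CharP.char_is_prime F _⟩

attribute [local instance] fact_prime_ringChar

/-- The absolute trace of a finite field. -/
def absTrace (F : Type*) [Field F] : F →+ ZMod (ringChar F) :=
  letI : Algebra (ZMod (ringChar F)) F := ZMod.algebra F (ringChar F)
  (Algebra.trace (ZMod (ringChar F)) F).toAddMonoidHom

theorem chi_eq (x : F) : chi x = ZMod.stdAddChar (absTrace F x) := by
  rw [chi, ZMod.stdAddChar_apply, ZMod.toCircle_apply]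
  rfl

theorem eq_zero_of_absTrace_mul {x : F} (h : ∀ y, absTrace F (x * y) = 0) : x = 0 := by
  by_contra hx
  let _ : Algebra (ZMod (ringChar F)) F := ZMod.algebra F (ringChar F)
  obtain ⟨b, hb⟩ := FiniteField.trace_to_zmod_nondegenerate F hx
  exact hb (h b)

/-- Symbols of Pauli operators. -/
abbrev Symbol (F : Type*) [Field F] : Type _ := (ℤ →₀ F) × (ℤ →₀ F)

/-- The Pauli operator `ω ^ c • ⨂ X(a i) Z(b i)`. -/
def pauliOp (c : ZMod (ringChar F)) (w : Symbol F) : Op F :=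
  LinearEquiv.smulOfNeZero ℂ (State F) (ZMod.stdAddChar c) (by
    rw [ZMod.stdAddChar_apply]; exact Circle.coe_ne_zero _) * (pauliX w.1 * pauliZ w.2)

theorem pauliOp_apply (c : ZMod (ringChar F)) (w : Symbol F) (ψ : State F) (x : ℤ → F) :
    pauliOp c w ψ x =
      ZMod.stdAddChar (c + absTrace F (dot w.2 (x - ⇑w.1))) * ψ (x - ⇑w.1) := by
  rw [AddChar.map_add_eq_mul, ← chi_eq, mul_assoc]
  rfl

/-- The bilinear form `tr (b · a')`, which is the phase in the product of two Pauli operators. -/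
def phaseForm (w w' : Symbol F) : ZMod (ringChar F) := absTrace F (dot w.2 w'.1)

/-- The only reordering is that of `Z(b)` past `X(a')`, which costs the phase `tr(b · a')`. -/
theorem pauliOp_mul (c c' : ZMod (ringChar F)) (w w' : Symbol F) :
    pauliOp c w * pauliOp c' w' = pauliOp (c + c' + phaseForm w w') (w + w') := by
  refine LinearEquiv.ext fun ψ => funext fun x => ?_
  rw [LinearEquiv.mul_apply, pauliOp_apply, pauliOp_apply, pauliOp_apply, ← mul_assoc,
    ← AddChar.map_add_eq_mul]
  have h : x - ⇑w.1 - ⇑w'.1 = x - ⇑(w + w').1 := by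
    rw [Prod.fst_add, Finsupp.coe_add, sub_sub]
  rw [h]
  congr 2
  rw [phaseForm, Prod.snd_add, dot_add_left, ← h, map_add]
  simp only [dot_sub_right, map_sub]
  ring

theorem pauliOp_zero : pauliOp 0 (0 : Symbol F) = 1 := by
  refine LinearEquiv.ext fun ψ => funext fun x => ?_
  rw [pauliOp_apply]
  simp [dot_zero_left]

/-- A basis state detects the translation `a`; the constant amplitude then detects the phase
function, whose value at `0` is `c` and whose values at single-site configurations determine `b`, by
nondegeneracy of the trace. -/
theorem pauliOp_injective {c c' : ZMod (ringChar F)} {w w' : Symbol F}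
    (h : pauliOp c w = pauliOp c' w') : c = c' ∧ w = w' := by
  classical
  have key : ∀ (ψ : State F) (y : ℤ → F),
      ZMod.stdAddChar (c + absTrace F (dot w.2 y)) * ψ y =
      ZMod.stdAddChar (c' + absTrace F (dot w'.2 (y + ⇑w.1 - ⇑w'.1))) * ψ (y + ⇑w.1 - ⇑w'.1) := by
    intro ψ y
    have := congrFun (congrArg (fun g : Op F => g ψ) h) (y + ⇑w.1)
    simpa only [pauliOp_apply, add_sub_cancel_right] using this
  have h1 : w.1 = w'.1 := by
    by_contra hne
    have := key (fun y => if y = 0 then 1 else 0) 0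
    have hne' : ¬ ((0 : ℤ → F) + ⇑w.1 - ⇑w'.1 = 0) := by
      rw [zero_add, sub_eq_zero]
      exact fun h => hne (DFunLike.coe_injective h)
    rw [if_pos rfl, if_neg hne', mul_zero, mul_one, ZMod.stdAddChar_apply] at this
    exact Circle.coe_ne_zero _ this
  have key2 : ∀ y : ℤ → F, c + absTrace F (dot w.2 y) = c' + absTrace F (dot w'.2 y) := by
    intro y
    have := key (fun _ => 1) y
    rw [h1, add_sub_cancel_right, mul_one, mul_one] at this
    exact ZMod.injective_stdAddChar this
  have hc : c = c' := by
    have := key2 0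
    simpa only [dot_zero_right, map_zero, add_zero] using this
  refine ⟨hc, Prod.ext h1 (Finsupp.ext fun i => sub_eq_zero.1 ?_)⟩
  refine eq_zero_of_absTrace_mul fun y => ?_
  have := key2 (Finsupp.single i y)
  rw [hc, add_right_inj, dot_single_right, dot_single_right] at this
  rw [sub_mul, map_sub, this, sub_self]

theorem isSymbol_iff {g : Op F} {a b : ℤ →₀ F} : IsSymbol g a b ↔ ∃ c, g = pauliOp c (a, b) := by
  have key : ∀ c : ℕ, ZMod.stdAddChar (c : ZMod (ringChar F)) =
      Complex.exp (2 * Real.pi * Complex.I * (c : ℂ) / (ringChar F : ℂ)) := by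
    intro c
    have := ZMod.stdAddChar_coe (N := ringChar F) c
    simpa using this
  constructor
  · rintro ⟨c, hc⟩
    refine ⟨c, LinearEquiv.ext fun ψ => ?_⟩
    rw [hc ψ, ← key]
    rfl
  · rintro ⟨c, rfl⟩
    refine ⟨c.val, fun ψ => ?_⟩
    rw [← key, ZMod.natCast_zmod_val]
    rfl

theorem pauliOp_mul_comm_iff {c c' : ZMod (ringChar F)} {w w' : Symbol F} :
    pauliOp c w * pauliOp c' w' = pauliOp c' w' * pauliOp c w ↔
      phaseForm w w' = phaseForm w' w := by
  rw [pauliOp_mul, pauliOp_mul, add_comm c' c, add_comm w' w]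
  exact ⟨fun h => add_left_cancel (pauliOp_injective h).1, fun h => by rw [h]⟩

theorem phaseForm_add_left (w₁ w₂ w : Symbol F) :
    phaseForm (w₁ + w₂) w = phaseForm w₁ w + phaseForm w₂ w := by
  rw [phaseForm, Prod.snd_add, dot_add_left, map_add]; rfl

theorem phaseForm_zero_left (w : Symbol F) : phaseForm 0 w = 0 := by
  rw [phaseForm, Prod.snd_zero, dot_zero_left, map_zero]

theorem phaseForm_zero_right (w : Symbol F) : phaseForm w 0 = 0 := by
  rw [phaseForm, Prod.fst_zero, Finsupp.coe_zero, dot_zero_right, map_zero]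

theorem phaseForm_neg_right (w w' : Symbol F) : phaseForm w (-w') = -phaseForm w w' := by
  rw [phaseForm, Prod.fst_neg, Finsupp.coe_neg, dot_neg_right, map_neg]; rfl

theorem phaseForm_nsmul_left (k : ℕ) (w w' : Symbol F) :
    phaseForm (k • w) w' = k * phaseForm w w' := by
  induction k with
  | zero => simp [phaseForm_zero_left]
  | succ k ih => rw [succ_nsmul, phaseForm_add_left, ih]; push_cast; ring

theorem pauliOp_inv (c : ZMod (ringChar F)) (w : Symbol F) :
    (pauliOp c w)⁻¹ = pauliOp (-c + phaseForm w w) (-w) := by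
  rw [inv_eq_iff_mul_eq_one, pauliOp_mul, phaseForm_neg_right, add_neg_cancel, ← pauliOp_zero]
  congr 1
  ring

/-- Each pair of factors contributes one phase `tr(b · a)`. For `k = p` the binomial term is all
that remains, and it decides whether the operator has order dividing `p`. -/
theorem pauliOp_pow (c : ZMod (ringChar F)) (w : Symbol F) (k : ℕ) :
    pauliOp c w ^ k = pauliOp ((k : ZMod (ringChar F)) * c + ((k.choose 2 : ℕ) : ZMod (ringChar F)) * phaseForm w w) (k • w) := by
  induction k with
  | zero => simp [pauliOp_zero]
  | succ k ih =>
    rw [pow_succ, ih, pauliOp_mul, phaseForm_nsmul_left, ← succ_nsmul, Nat.choose_succ_succ' k 1,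
      Nat.choose_one_right]
    congr 1
    push_cast
    ring

/-- The Pauli operators with symbols in `W`. -/
def symbolGroup (W : AddSubgroup (Symbol F)) : Subgroup (Op F) where
  carrier := {g | ∃ c, ∃ w ∈ W, g = pauliOp c w}
  one_mem' := ⟨0, 0, W.zero_mem, pauliOp_zero.symm⟩
  mul_mem' := by
    rintro _ _ ⟨c, w, hw, rfl⟩ ⟨c', w', hw', rfl⟩
    exact ⟨_, _, W.add_mem hw hw', pauliOp_mul ..⟩
  inv_mem' := by
    rintro _ ⟨c, w, hw, rfl⟩
    exact ⟨_, _, W.neg_mem hw, pauliOp_inv ..⟩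

theorem pauliOp_mem_symbolGroup {W : AddSubgroup (Symbol F)} {c : ZMod (ringChar F)}
    {w : Symbol F} : pauliOp c w ∈ symbolGroup W ↔ w ∈ W := by
  constructor
  · rintro ⟨c', w', hw', h⟩
    rwa [(pauliOp_injective h).2]
  · exact fun h => ⟨c, w, h, rfl⟩

/-- The symbols that vanish outside `I`. -/
def supportedSymbols (F : Type*) [Field F] (I : Set ℤ) : AddSubgroup (Symbol F) where
  carrier := {w | ∀ i, i ∉ I → w.1 i = 0 ∧ w.2 i = 0}
  zero_mem' := fun i _ => ⟨rfl, rfl⟩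
  add_mem' := fun {w w'} h h' i hi => by
    simp [(h i hi).1, (h i hi).2, (h' i hi).1, (h' i hi).2]
  neg_mem' := fun {w} h i hi => by simp [(h i hi).1, (h i hi).2]

theorem pauliX_eq (a : ℤ →₀ F) : pauliX a = pauliOp 0 (a, 0) := by
  refine LinearEquiv.ext fun ψ => funext fun x => ?_
  rw [pauliOp_apply]
  simp only [dot_zero_left, map_zero, add_zero, AddChar.map_zero_eq_one, one_mul]
  rfl

theorem pauliZ_eq (b : ℤ →₀ F) : pauliZ b = pauliOp 0 (0, b) := by
  refine LinearEquiv.ext fun ψ => funext fun x => ?_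
  rw [pauliOp_apply, zero_add, ← chi_eq, Finsupp.coe_zero, sub_zero]
  rfl

theorem pauliGroup_le (I : Set ℤ) : pauliGroup F I ≤ symbolGroup (supportedSymbols F I) := by
  rw [pauliGroup, Subgroup.closure_le]
  rintro _ ⟨i, hi, y, rfl | rfl⟩
  · rw [pauliX_eq]
    refine ⟨_, _, fun j hj => ⟨?_, rfl⟩, rfl⟩
    exact Finsupp.single_eq_of_ne fun h => hj (h ▸ hi)
  · rw [pauliZ_eq]
    refine ⟨_, _, fun j hj => ⟨rfl, ?_⟩, rfl⟩
    exact Finsupp.single_eq_of_ne fun h => hj (h ▸ hi)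

theorem exists_absTrace_eq (c : ZMod (ringChar F)) : ∃ x : F, absTrace F x = c := by
  obtain ⟨y, hy⟩ : ∃ y, absTrace F y ≠ 0 := by
    by_contra! h
    exact one_ne_zero (eq_zero_of_absTrace_mul (x := (1 : F)) fun y => h _)
  refine ⟨(c * (absTrace F y)⁻¹).val • y, ?_⟩
  rw [map_nsmul, nsmul_eq_mul, ZMod.natCast_zmod_val, mul_assoc, inv_mul_cancel₀ hy, mul_one]

/-- Phases are commutators of `Z(x)` and `X(1)` at one site, so `I` must be nonempty; all of them
occur because the trace is onto. The rest is a product over single sites. -/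
theorem pauliOp_mem_pauliGroup {I : Set ℤ} (hI : I.Nonempty) (c : ZMod (ringChar F))
    {w : Symbol F} (hw : w ∈ supportedSymbols F I) : pauliOp c w ∈ pauliGroup F I := by
  have hX : ∀ i ∈ I, ∀ y, pauliOp 0 ((Finsupp.single i y, 0) : Symbol F) ∈ pauliGroup F I :=
    fun i hi y => Subgroup.subset_closure ⟨i, hi, y, Or.inl (pauliX_eq _).symm⟩
  have hZ : ∀ i ∈ I, ∀ y, pauliOp 0 ((0, Finsupp.single i y) : Symbol F) ∈ pauliGroup F I :=
    fun i hi y => Subgroup.subset_closure ⟨i, hi, y, Or.inr (pauliZ_eq _).symm⟩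
  have hphase : pauliOp c (0 : Symbol F) ∈ pauliGroup F I := by
    obtain ⟨i, hi⟩ := hI
    obtain ⟨x, rfl⟩ := exists_absTrace_eq c
    have h := mul_mem (mul_mem (hZ i hi x) (hX i hi 1)) (inv_mem (mul_mem (hX i hi 1) (hZ i hi x)))
    rw [pauliOp_mul, pauliOp_mul, pauliOp_inv, pauliOp_mul] at h
    convert h using 2
    · rw [phaseForm_neg_right]
      simp [phaseForm, dot_single_left, dot_zero_left]
    · rw [add_comm ((0, Finsupp.single i x) : Symbol F), add_neg_cancel]
  have hXall : ∀ a : ℤ →₀ F, (∀ i, i ∉ I → a i = 0) →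
      pauliOp 0 ((a, 0) : Symbol F) ∈ pauliGroup F I := by
    intro a
    induction a using Finsupp.induction with
    | zero => exact fun _ => pauliOp_zero (F := F) ▸ one_mem _
    | single_add i y a hi hy ih =>
      intro h
      have hiI : i ∈ I := by
        by_contra hiI
        have := h i hiI
        rw [Finsupp.add_apply, Finsupp.single_eq_same, Finsupp.notMem_support_iff.1 hi,
          add_zero] at this
        exact hy this
      have ha : ∀ j, j ∉ I → a j = 0 := by
        intro j hj
        have := h j hj
        rwa [Finsupp.add_apply, Finsupp.single_eq_of_ne (by rintro rfl; exact hj hiI), zero_add] at this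
      have := mul_mem (hX i hiI y) (ih ha)
      rw [pauliOp_mul] at this
      simpa [phaseForm, dot_zero_left] using this
  have hZall : ∀ a : ℤ →₀ F, (∀ i, i ∉ I → a i = 0) →
      pauliOp 0 ((0, a) : Symbol F) ∈ pauliGroup F I := by
    intro a
    induction a using Finsupp.induction with
    | zero => exact fun _ => pauliOp_zero (F := F) ▸ one_mem _
    | single_add i y a hi hy ih =>
      intro h
      have hiI : i ∈ I := by
        by_contra hiI
        have := h i hiI
        rw [Finsupp.add_apply, Finsupp.single_eq_same, Finsupp.notMem_support_iff.1 hi,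
          add_zero] at this
        exact hy this
      have ha : ∀ j, j ∉ I → a j = 0 := by
        intro j hj
        have := h j hj
        rwa [Finsupp.add_apply, Finsupp.single_eq_of_ne (by rintro rfl; exact hj hiI), zero_add] at this
      have := mul_mem (hZ i hiI y) (ih ha)
      rw [pauliOp_mul] at this
      simpa [phaseForm, dot_zero_right] using this
  have h := mul_mem (mul_mem hphase (hXall w.1 fun i hi => (hw i hi).1))
    (hZall w.2 fun i hi => (hw i hi).2)
  rw [pauliOp_mul, pauliOp_mul] at h
  simpa [phaseForm, dot_zero_left] using h

theorem pauliOp_mem_pauliInf (c : ZMod (ringChar F)) (w : Symbol F) :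
    pauliOp c w ∈ pauliInf F :=
  pauliOp_mem_pauliGroup Set.univ_nonempty c fun i hi => absurd (Set.mem_univ i) hi

/-- The central elements of a Pauli group are scalar. -/
theorem centerOf_pauliGroup_le (I : Set ℤ) :
    centerOf (pauliGroup F I) ≤ symbolGroup (⊥ : AddSubgroup (Symbol F)) := by
  rintro g ⟨hg, hc⟩
  obtain ⟨c, w, hw, rfl⟩ := pauliGroup_le I hg
  refine ⟨c, w, ?_, rfl⟩
  rw [AddSubgroup.mem_bot]
  refine Prod.ext (Finsupp.ext fun i => ?_) (Finsupp.ext fun i => ?_)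
  · by_cases hi : i ∈ I
    · refine eq_zero_of_absTrace_mul fun y => ?_
      have := Subgroup.mem_centralizer_iff.1 hc _
        (Subgroup.subset_closure ⟨i, hi, y, Or.inr rfl⟩)
      rw [pauliZ_eq, pauliOp_mul_comm_iff] at this
      simpa [phaseForm, dot_single_left, dot_zero_right, mul_comm] using this
    · exact (hw i hi).1
  · by_cases hi : i ∈ I
    · refine eq_zero_of_absTrace_mul fun y => ?_
      have := Subgroup.mem_centralizer_iff.1 hc _
        (Subgroup.subset_closure ⟨i, hi, y, Or.inl rfl⟩)
      rw [pauliX_eq, pauliOp_mul_comm_iff] at this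
      simpa [phaseForm, dot_single_right, dot_zero_left, eq_comm] using this
    · exact (hw i hi).2

/-- A product of a scalar Pauli operator and an element of `S` has the symbol of an element
of `S`. -/
theorem exists_mem_of_mem_centerOf_sup {S : Subgroup (Op F)} {c : ZMod (ringChar F)}
    {w : Symbol F} (h : pauliOp c w ∈ centerOf (pauliInf F) ⊔ S) :
    ∃ c', pauliOp c' w ∈ S := by
  -- Scalars commute with every linear operator, so this subgroup is normal in the whole of `Op F`
  -- and the join below is a set of products.
  have hN : (symbolGroup (⊥ : AddSubgroup (Symbol F))).Normal := by
    refine ⟨?_⟩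
    rintro _ ⟨c, w, hw, rfl⟩ g
    rw [AddSubgroup.mem_bot.1 hw]
    have : g * pauliOp c 0 = pauliOp c 0 * g := by
      have hs : ∀ ψ : State F, pauliOp c 0 ψ = ZMod.stdAddChar c • ψ := fun ψ => by
        funext x
        rw [pauliOp_apply]
        simp [dot_zero_left]
      refine LinearEquiv.ext fun ψ => ?_
      rw [LinearEquiv.mul_apply, LinearEquiv.mul_apply, hs, hs, map_smul]
    rw [this, mul_inv_cancel_right]
    exact ⟨c, 0, AddSubgroup.zero_mem _, rfl⟩
  have h' := sup_le_sup_right (centerOf_pauliGroup_le (F := F) Set.univ) S h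
  obtain ⟨_, ⟨d, v, hv, rfl⟩, g, hg, hgw⟩ := Subgroup.mem_sup_of_normal_left.1 h'
  rw [AddSubgroup.mem_bot.1 hv] at hgw
  have : g = pauliOp (c - d) w := by
    rw [← inv_mul_eq_iff_eq_mul.2 hgw.symm, pauliOp_inv, pauliOp_mul, phaseForm_zero_left, neg_zero,
      phaseForm_zero_left, zero_add]
    congr 1
    ring
  exact ⟨_, this ▸ hg⟩

/-- The translation of symbols by `l` places to the right. -/
def translateSymbol (F : Type*) [Field F] (l : ℤ) : Symbol F ≃ₗ[F] Symbol F :=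
  (translateSeq F F l).prodCongr (translateSeq F F l)

theorem shift_pauliOp (l : ℤ) (c : ZMod (ringChar F)) (w : Symbol F) :
    shift F l (pauliOp c w) = pauliOp c (translateSymbol F l w) := by
  have h : translate F l * pauliOp c w = pauliOp c (translateSymbol F l w) * translate F l := by
    refine LinearEquiv.ext fun ψ => funext fun x => ?_
    rw [LinearEquiv.mul_apply, LinearEquiv.mul_apply, pauliOp_apply]
    have ht : ∀ (φ : State F) (y : ℤ → F), translate F l φ y = φ fun i => y (i + l) :=
      fun _ _ => rfl
    rw [ht, ht, pauliOp_apply]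
    have h2 : (fun i => (x - ⇑(translateSymbol F l w).1) (i + l)) =
        (fun i => x (i + l)) - ⇑w.1 := by
      funext i
      have : (translateSymbol F l w).1 (i + l) = w.1 i := by
        change w.1 (i + l - l) = _
        rw [add_sub_cancel_right]
      simp [this]
    rw [h2]
    have h3 : dot (translateSymbol F l w).2 (x - ⇑(translateSymbol F l w).1) =
        dot w.2 ((fun i => x (i + l)) - ⇑w.1) := by
      rw [← h2]
      exact dot_translateSeq l w.2 _
    rw [h3]
  rw [shift, MulEquiv.toMonoidHom_eq_coe, MonoidHom.coe_coe, MulAut.conj_apply, h,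
    mul_inv_cancel_right]

end Pauli

set_option linter.unusedSectionVars false

/-! ### The map `τ`, and the symplectic form as the skew part of the Hermitian form. -/

section Tau

variable {F K : Type*} [Field F] [Fintype F] [Field K] [Fintype K] [Algebra F K]

attribute [local instance] fact_prime_ringChar

local notation "σ" => FiniteField.frobeniusAlgHom F K

/-- The map `(a, b) ↦ (β a i + β ^ q b i)` from symbols to sequences over `K`. -/
def tauSeq (β : K) : Symbol F →ₗ[F] (ℤ →₀ K) :=
  (Finsupp.mapRange.linearMap (LinearMap.toSpanSingleton F K β)).comp (LinearMap.fst F _ _) +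
  (Finsupp.mapRange.linearMap (LinearMap.toSpanSingleton F K (σ β))).comp (LinearMap.snd F _ _)

theorem tauSeq_apply (β : K) (w : Symbol F) (i : ℤ) :
    tauSeq β w i = β * algebraMap F K (w.1 i) + σ β * algebraMap F K (w.2 i) := by
  simp [tauSeq, Algebra.smul_def, mul_comm]

theorem isTau_iff {β : K} {g : Op F} {v : ℤ → K} :
    IsTau β g v ↔ ∃ c w, g = pauliOp c w ∧ v = ⇑(tauSeq β w) := by
  have key : ∀ (w : Symbol F) i, tauSeq β w i =
      β * algebraMap F K (w.1 i) + β ^ Nat.card F * algebraMap F K (w.2 i) := fun w i => by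
    rw [tauSeq_apply, FiniteField.coe_frobeniusAlgHom, Nat.card_eq_fintype_card]
  constructor
  · rintro ⟨a, b, hg, hv⟩
    obtain ⟨c, rfl⟩ := isSymbol_iff.1 hg
    exact ⟨c, (a, b), rfl, funext fun i => by rw [hv, key]⟩
  · rintro ⟨c, w, rfl, rfl⟩
    exact ⟨w.1, w.2, isSymbol_iff.2 ⟨c, rfl⟩, key w⟩

theorem frobenius_frobenius (hK : Fintype.card K = Fintype.card F ^ 2) (x : K) : σ (σ x) = x := by
  rw [FiniteField.coe_frobeniusAlgHom]
  dsimp only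
  rw [← pow_mul, ← sq, ← hK, FiniteField.pow_card]

theorem tauSeq_injective {β : K} (hβ : LinearIndependent F ![β, σ β]) :
    Function.Injective (tauSeq β : Symbol F →ₗ[F] (ℤ →₀ K)) := by
  rw [injective_iff_map_eq_zero]
  intro w hw
  have h : ∀ i, w.1 i = 0 ∧ w.2 i = 0 := by
    intro i
    refine LinearIndependent.pair_iff.1 hβ _ _ ?_
    rw [Algebra.smul_def, Algebra.smul_def, mul_comm, mul_comm _ (σ β), ← tauSeq_apply, hw]
    rfl
  exact Prod.ext (Finsupp.ext fun i => (h i).1) (Finsupp.ext fun i => (h i).2)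

theorem tauSeq_surjective (hK : Fintype.card K = Fintype.card F ^ 2) {β : K}
    (hβ : LinearIndependent F ![β, σ β]) :
    Function.Surjective (tauSeq β : Symbol F →ₗ[F] (ℤ →₀ K)) := by
  have hfin : Module.finrank F K = 2 := by
    have := Module.card_eq_pow_finrank (K := F) (V := K)
    rw [hK] at this
    exact (Nat.pow_right_injective Fintype.one_lt_card this).symm
  have hsurj : ∀ x : K, ∃ a b : F, β * algebraMap F K a + σ β * algebraMap F K b = x := by
    intro x
    have htop := hβ.span_eq_top_of_card_eq_finrank' (by rw [hfin, Fintype.card_fin])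
    have hx : x ∈ Submodule.span F (Set.range ![β, σ β]) := htop ▸ Submodule.mem_top
    rw [Matrix.range_cons, Matrix.range_cons, Matrix.range_empty, Set.union_empty,
      Set.singleton_union] at hx
    obtain ⟨a, b, h⟩ := Submodule.mem_span_pair.1 hx
    exact ⟨a, b, by rw [← h, Algebra.smul_def, Algebra.smul_def, mul_comm, mul_comm (σ β)]⟩
  intro v
  induction v using Finsupp.induction_linear with
  | zero => exact ⟨0, map_zero _⟩
  | add v v' h h' =>
    obtain ⟨w, rfl⟩ := h
    obtain ⟨w', rfl⟩ := h'
    exact ⟨w + w', map_add ..⟩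
  | single i x =>
    obtain ⟨a, b, rfl⟩ := hsurj x
    refine ⟨(Finsupp.single i a, Finsupp.single i b), Finsupp.ext fun j => ?_⟩
    rw [tauSeq_apply]
    by_cases hj : j = i
    · subst hj; simp
    · simp [Finsupp.single_eq_of_ne hj]

/-- `τ` as an isomorphism between symbols and sequences over `K`. -/
def tauEquiv (hK : Fintype.card K = Fintype.card F ^ 2) {β : K}
    (hβ : LinearIndependent F ![β, σ β]) : Symbol F ≃ₗ[F] (ℤ →₀ K) :=
  LinearEquiv.ofBijective (tauSeq β) ⟨tauSeq_injective hβ, tauSeq_surjective hK hβ⟩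

theorem tauSeq_ne_zero_iff {β : K} (hβ : LinearIndependent F ![β, σ β]) (w : Symbol F) (i : ℤ) :
    tauSeq β w i ≠ 0 ↔ w.1 i ≠ 0 ∨ w.2 i ≠ 0 := by
  rw [← not_and_or, not_iff_not]
  constructor
  · intro h
    refine LinearIndependent.pair_iff.1 hβ _ _ ?_
    rw [Algebra.smul_def, Algebra.smul_def, mul_comm, mul_comm _ (σ β), ← tauSeq_apply, h]
  · rintro ⟨h, h'⟩
    rw [tauSeq_apply, h, h']
    simp

/-- By independence of `β` and `β^q`, a tensor factor is scalar exactly when the `τ`-coordinate at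
its site is zero; quantum weight is Hamming weight. -/
theorem hasWeight_pauliOp_iff {β : K} (hβ : LinearIndependent F ![β, σ β])
    (c : ZMod (ringChar F)) (w : Symbol F) (d : ℕ) :
    HasWeight (pauliOp c w) d ↔ (tauSeq β w).support.card = d := by
  have key : Set.ncard {i : ℤ | w.1 i ≠ 0 ∨ w.2 i ≠ 0} = (tauSeq β w).support.card := by
    rw [← Set.ncard_coe_finset]
    congr 1
    ext i
    rw [Set.mem_ofPred_eq, ← tauSeq_ne_zero_iff hβ, Finset.mem_coe, Finsupp.mem_support_iff]
  constructor
  · rintro ⟨a, b, h, rfl⟩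
    obtain ⟨c', h'⟩ := isSymbol_iff.1 h
    obtain ⟨-, rfl⟩ := pauliOp_injective h'
    exact key.symm
  · rintro rfl
    exact ⟨w.1, w.2, isSymbol_iff.2 ⟨c, rfl⟩, key⟩

theorem tauSeq_translateSymbol (β : K) (l : ℤ) (w : Symbol F) :
    tauSeq β (translateSymbol F l w) = translateSeq K K l (tauSeq β w) :=
  Finsupp.ext fun i => by rw [translateSeq_apply, tauSeq_apply, tauSeq_apply]; rfl

/-- The Hermitian form `∑ v i * (v' i) ^ q`. -/
def herm (F : Type*) [Field F] [Fintype F] [Algebra F K] (v v' : ℤ →₀ K) : K :=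
  v.sum fun i y => y * FiniteField.frobeniusAlgHom F K (v' i)

theorem herm_eq_sum {v v' : ℤ →₀ K} {s : Finset ℤ} (hs : v.support ⊆ s) :
    herm F v v' = ∑ i ∈ s, v i * σ (v' i) :=
  Finsupp.sum_of_support_subset _ hs _ (by simp)

theorem herm_add_right (v v₁ v₂ : ℤ →₀ K) : herm F v (v₁ + v₂) = herm F v v₁ + herm F v v₂ := by
  simp only [herm, Finsupp.add_apply, map_add, mul_add, Finsupp.sum_add]

theorem herm_smul_right (v v' : ℤ →₀ K) (x : K) : herm F v (x • v') = σ x * herm F v v' := by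
  rw [herm, herm, Finsupp.mul_sum]
  refine Finsupp.sum_congr fun i _ => ?_
  rw [Finsupp.smul_apply, smul_eq_mul, map_mul]
  ring

theorem dot_eq_sum {b : ℤ →₀ F} {x : ℤ → F} {s : Finset ℤ} (hs : b.support ⊆ s) :
    dot b x = ∑ i ∈ s, b i * x i :=
  Finsupp.sum_of_support_subset _ hs _ (by simp)

/-- The skew-Hermitian part of the Hermitian form is a multiple of the symplectic form. -/
theorem herm_sub_frobenius (hK : Fintype.card K = Fintype.card F ^ 2) (β : K) (w w' : Symbol F) :
    herm F (tauSeq β w) (tauSeq β w') - σ (herm F (tauSeq β w) (tauSeq β w')) =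
      (β ^ 2 - σ β ^ 2) * algebraMap F K (dot w'.2 w.1 - dot w.2 w'.1) := by
  classical
  set s := (tauSeq β w).support ∪ (w'.2.support ∪ w.2.support)
  have h1 : (tauSeq β w).support ⊆ s := Finset.subset_union_left
  have h2 : w'.2.support ⊆ s := Finset.subset_union_left.trans Finset.subset_union_right
  have h3 : w.2.support ⊆ s := Finset.subset_union_right.trans Finset.subset_union_right
  rw [herm_eq_sum h1, dot_eq_sum h2, dot_eq_sum h3, map_sum, ← Finset.sum_sub_distrib,
    ← Finset.sum_sub_distrib, map_sum, Finset.mul_sum]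
  refine Finset.sum_congr rfl fun i _ => ?_
  simp only [tauSeq_apply, map_add, map_mul, map_sub, frobenius_frobenius hK, AlgHom.commutes]
  ring

/-- Otherwise `β = β^q` or `β = -β^q`, and both are linear relations over `F`. -/
theorem sq_sub_sq_frobenius_ne_zero {β : K} (hβ : LinearIndependent F ![β, σ β]) :
    β ^ 2 - σ β ^ 2 ≠ 0 := by
  intro h
  rw [LinearIndependent.pair_iff] at hβ
  rcases mul_eq_zero.1 ((sq_sub_sq β (σ β)).symm.trans h) with h | h
  · exact one_ne_zero (hβ 1 1 (by rw [one_smul, one_smul, h])).1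
  · exact one_ne_zero (hβ 1 (-1) (by rw [one_smul, neg_smul, one_smul, ← sub_eq_add_neg, h])).1

theorem dot_comm_of_herm_eq_zero (hK : Fintype.card K = Fintype.card F ^ 2) {β : K}
    (hβ : LinearIndependent F ![β, σ β]) {w w' : Symbol F}
    (h : herm F (tauSeq β w) (tauSeq β w') = 0) : dot w.2 w'.1 = dot w'.2 w.1 := by
  have := herm_sub_frobenius hK β w w'
  rw [h, map_zero, sub_zero, eq_comm] at this
  have := (mul_eq_zero.1 this).resolve_left (sq_sub_sq_frobenius_ne_zero hβ)
  rw [map_eq_zero, sub_eq_zero] at this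
  exact this.symm

theorem phaseForm_comm_of_herm_eq_zero (hK : Fintype.card K = Fintype.card F ^ 2) {β : K}
    (hβ : LinearIndependent F ![β, σ β]) {w w' : Symbol F}
    (h : herm F (tauSeq β w) (tauSeq β w') = 0) : phaseForm w w' = phaseForm w' w := by
  rw [phaseForm, phaseForm, dot_comm_of_herm_eq_zero hK hβ h]

/-- A single commutation relation controls only a trace of the skew part of the form. Letting `v'`
run through its `K`-multiples makes a nonzero Hermitian product take every value, so the trace of
every element of `F` would vanish. -/
theorem herm_eq_zero_of_phaseForm_comm (hK : Fintype.card K = Fintype.card F ^ 2) {β : K}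
    (hβ : LinearIndependent F ![β, σ β]) {w : Symbol F} {v' : ℤ →₀ K}
    (h : ∀ (x : K) (w' : Symbol F), tauSeq β w' = x • v' → phaseForm w w' = phaseForm w' w) :
    herm F (tauSeq β w) v' = 0 := by
  by_contra hne
  refine one_ne_zero (α := F) (eq_zero_of_absTrace_mul fun f => ?_)
  rw [one_mul]
  set y := algebraMap F K f * β ^ 2
  -- The form is conjugate-linear in its second argument, so this multiple has Hermitian product `y
  -- = f β²`, whose skew part is `(β² - β^(2q)) f`.
  obtain ⟨w', hw'⟩ := tauSeq_surjective hK hβ (σ (y / herm F (tauSeq β w) v') • v')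
  have h1 := herm_sub_frobenius hK β w w'
  rw [hw', herm_smul_right, frobenius_frobenius hK, div_mul_cancel₀ _ hne] at h1
  have h2 : y - σ y = (β ^ 2 - σ β ^ 2) * algebraMap F K f := by
    simp only [y, map_mul, AlgHom.commutes, map_pow]
    ring
  rw [h2] at h1
  have h3 := (algebraMap F K).injective (mul_left_cancel₀ (sq_sub_sq_frobenius_ne_zero hβ) h1)
  rw [h3, map_sub, sub_eq_zero]
  exact (h _ w' hw').symm

/-- Pauli operators whose `τ`-sequence is self-orthogonal and has sum zero have order `p`, up to
a scalar of order `p`. -/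
theorem choose_mul_phaseForm_self (hK : Fintype.card K = Fintype.card F ^ 2) {β : K}
    (hβ : LinearIndependent F ![β, σ β]) {w : Symbol F}
    (h : herm F (tauSeq β w) (tauSeq β w) = 0) (hsum : ((tauSeq β w).sum fun _ y => y) = 0) :
    (((ringChar F).choose 2 : ℕ) : ZMod (ringChar F)) * phaseForm w w = 0 := by
  classical
  have hp : (ringChar F).Prime := (fact_prime_ringChar F).out
  rcases hp.eq_two_or_odd with h2 | hodd
  · suffices hd : dot w.2 w.1 = 0 by rw [phaseForm, hd, map_zero, mul_zero]
    have hF2 : (2 : F) = 0 := by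
      have := ringChar.Nat.cast_ringChar (R := F)
      rw [h2] at this
      exact_mod_cast this
    have : CharP F 2 := by
      have := ringChar.charP F
      rwa [h2] at this
    set s := (tauSeq β w).support ∪ w.2.support
    have h1 : (tauSeq β w).support ⊆ s := Finset.subset_union_left
    have h3 : w.2.support ⊆ s := Finset.subset_union_right
    rw [Finsupp.sum_of_support_subset _ h1 _ (by simp)] at hsum
    simp only [tauSeq_apply, Finset.sum_add_distrib, ← Finset.mul_sum, ← map_sum] at hsum
    -- The zero sum splits into `∑ a i = 0` and `∑ b i = 0`. In characteristic `2` squaring is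
    -- additive, so the diagonal terms of the Hermitian form drop out and only the multiple of `b ·
    -- a` is left.
    have hab := LinearIndependent.pair_iff.1 hβ (∑ i ∈ s, w.1 i) (∑ i ∈ s, w.2 i) (by
      rw [Algebra.smul_def, Algebra.smul_def, mul_comm, mul_comm _ (σ β), hsum])
    have ha2 : ∑ i ∈ s, w.1 i ^ 2 = 0 := by rw [← CharTwo.sum_sq, hab.1, zero_pow two_ne_zero]
    have hb2 : ∑ i ∈ s, w.2 i ^ 2 = 0 := by rw [← CharTwo.sum_sq, hab.2, zero_pow two_ne_zero]
    have key : herm F (tauSeq β w) (tauSeq β w) = β * σ β * algebraMap F K (∑ i ∈ s, w.1 i ^ 2) +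
        β * σ β * algebraMap F K (∑ i ∈ s, w.2 i ^ 2) +
        (β ^ 2 + σ β ^ 2) * algebraMap F K (dot w.2 w.1) := by
      rw [herm_eq_sum h1, dot_eq_sum h3]
      simp only [map_sum, Finset.mul_sum, ← Finset.sum_add_distrib]
      refine Finset.sum_congr rfl fun i _ => ?_
      simp only [tauSeq_apply, map_add, map_mul, map_pow, frobenius_frobenius hK,
        AlgHom.commutes]
      ring
    rw [h, ha2, hb2, map_zero, mul_zero, zero_add, zero_add, eq_comm] at key
    have hK2 : (2 : K) = 0 := by
      rw [← map_ofNat (algebraMap F K) 2, hF2, map_zero]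
    have hne : β ^ 2 + σ β ^ 2 ≠ 0 := by
      have := sq_sub_sq_frobenius_ne_zero hβ
      rwa [show β ^ 2 - σ β ^ 2 = β ^ 2 + σ β ^ 2 - 2 * σ β ^ 2 by ring, hK2, zero_mul,
        sub_zero] at this
    simpa using (mul_eq_zero.1 key).resolve_left hne
  · have hlt : 2 < ringChar F :=
      lt_of_le_of_ne hp.two_le fun h => by rw [← h] at hodd; omega
    rw [(ZMod.natCast_eq_zero_iff _ _).2 (hp.dvd_choose_self two_ne_zero hlt), zero_mul]

end Tau

/-! ### Cutting sequences into blocks of length `n`. -/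

section Blocks

variable {K : Type*} [Field K] {n : ℕ} [NeZero n]

/-- The sequence over `K` with the given blocks of length `n`. -/
def unblock (K : Type*) [Field K] (n : ℕ) [NeZero n] : (ℤ →₀ (Fin n → K)) ≃ₗ[K] (ℤ →₀ K) :=
  (Finsupp.mapRange.linearEquiv (Finsupp.linearEquivFunOnFinite K K (Fin n)).symm).trans
    ((Finsupp.curryLinearEquiv K).symm.trans
      (Finsupp.domLCongr (Int.divModEquiv n).symm))

theorem unblock_apply (f : ℤ →₀ (Fin n → K)) (l : ℤ) (i : Fin n) :
    unblock K n f (l * n + i) = f l i := by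
  have : (l * n + i : ℤ) = (Int.divModEquiv n).symm (l, i) := rfl
  rw [this]
  change f ((Int.divModEquiv n) ((Int.divModEquiv n).symm (l, i))).1
    ((Int.divModEquiv n) ((Int.divModEquiv n).symm (l, i))).2 = f l i
  rw [Equiv.apply_symm_apply]

theorem exists_eq_mul_add (n : ℕ) [NeZero n] (N : ℤ) : ∃ (l : ℤ) (i : Fin n), N = l * n + i :=
  ⟨_, _, ((Int.divModEquiv n).symm_apply_apply N).symm⟩

theorem translateSeq_unblock (l : ℤ) (f : ℤ →₀ (Fin n → K)) :
    translateSeq K K (l * n) (unblock K n f) = unblock K n (translateSeq K (Fin n → K) l f) := by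
  ext N
  obtain ⟨l', i, rfl⟩ := exists_eq_mul_add n N
  rw [translateSeq_apply, unblock_apply, translateSeq_apply, ← unblock_apply]
  congr 1
  ring

theorem sum_unblock {M : Type*} [AddCommMonoid M] (f : ℤ →₀ (Fin n → K)) (φ : ℤ → K → M)
    (hφ : ∀ N, φ N 0 = 0) :
    (unblock K n f).sum φ = f.sum fun l r => ∑ i : Fin n, φ (l * n + i) (r i) := by
  classical
  rw [Finsupp.sum_of_support_subset (unblock K n f)
    (s := (f.support ×ˢ Finset.univ).map (Int.divModEquiv n).symm.toEmbedding) ?_ φ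
      fun N _ => hφ N]
  · rw [Finset.sum_map, Finset.sum_product]
    refine Finset.sum_congr rfl fun l _ => Finset.sum_congr rfl fun i _ => ?_
    rw [← unblock_apply f l i]
    rfl
  · intro N hN
    obtain ⟨l, i, rfl⟩ := exists_eq_mul_add n N
    rw [Finsupp.mem_support_iff, unblock_apply] at hN
    refine Finset.mem_map.2 ⟨(l, i), ?_, rfl⟩
    rw [Finset.mem_product, Finsupp.mem_support_iff]
    exact ⟨fun h => hN (by rw [h]; rfl), Finset.mem_univ _⟩

theorem herm_unblock {F : Type*} [Field F] [Fintype F] [Algebra F K] [Fintype K]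
    (f : ℤ →₀ (Fin n → K)) (f' : ℤ →₀ (Fin n → K)) :
    herm F (unblock K n f) (unblock K n f') =
      f.sum fun l r => ∑ i, r i * FiniteField.frobeniusAlgHom F K (f' l i) := by
  rw [herm, sum_unblock _ _ (by simp)]
  simp only [unblock_apply]

theorem herm_unblock_single {F : Type*} [Field F] [Fintype F] [Algebra F K] [Fintype K]
    (f : ℤ →₀ (Fin n → K)) (l : ℤ) (r : Fin n → K) :
    herm F (unblock K n f) (unblock K n (Finsupp.single l r)) =
      ∑ i, f l i * FiniteField.frobeniusAlgHom F K (r i) := by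
  classical
  rw [herm_unblock, Finsupp.sum_of_support_subset f (s := insert l f.support)
    (Finset.subset_insert _ _) _ (by simp), Finset.sum_eq_single_of_mem l
    (Finset.mem_insert_self _ _), Finsupp.single_eq_same]
  intro l' _ hl'
  rw [Finsupp.single_eq_of_ne hl']
  simp

end Blocks

/-! ### Homomorphic choice of phases. -/

section Lift

variable {F : Type*} [Field F] [Finite F]

attribute [local instance] fact_prime_ringChar

/-- The group of Pauli operators with symbols in an isotropic subgroup is commutative. -/
theorem symbolGroup_comm {W : AddSubgroup (Symbol F)}
    (hcomm : ∀ w ∈ W, ∀ w' ∈ W, phaseForm w w' = phaseForm w' w) {g h : Op F}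
    (hg : g ∈ symbolGroup W) (hh : h ∈ symbolGroup W) : g * h = h * g := by
  obtain ⟨c, w, hw, rfl⟩ := hg
  obtain ⟨c', w', hw', rfl⟩ := hh
  exact pauliOp_mul_comm_iff.2 (hcomm w hw w' hw')

/-- Surjections between vector spaces over `ZMod p` split additively. -/
theorem exists_rightInverse_of_surjective {A B : Type*} [AddCommGroup A] [AddCommGroup B]
    (p : ℕ) [Fact p.Prime] [Module (ZMod p) A] [Module (ZMod p) B] (f : A →+ B)
    (hf : Function.Surjective f) : ∃ s : B →+ A, ∀ b, f (s b) = b := by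
  have : Module.Free (ZMod p) B := Module.Free.of_divisionRing (ZMod p) B
  obtain ⟨s, hs⟩ := Module.projective_lifting_property (f.toZModLinearMap p) LinearMap.id hf
  exact ⟨s.toAddMonoidHom, LinearMap.congr_fun hs⟩

/-- Surjections between groups of prime exponent split. -/
theorem exists_rightInverse_of_nsmul_eq_zero {A B : Type*} [AddCommGroup A] [AddCommGroup B]
    (p : ℕ) [Fact p.Prime] (hA : ∀ x : A, p • x = 0) (hB : ∀ x : B, p • x = 0) (f : A →+ B)
    (hf : Function.Surjective f) : ∃ s : B →+ A, ∀ b, f (s b) = b :=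
  @exists_rightInverse_of_surjective A B _ _ p _ (AddCommGroup.zmodModule hA)
    (AddCommGroup.zmodModule hB) f hf

/-- Isotropic groups of symbols that lift to operators of order `p` lift homomorphically. -/
theorem exists_section (W : AddSubgroup (Symbol F))
    (hcomm : ∀ w ∈ W, ∀ w' ∈ W, phaseForm w w' = phaseForm w' w)
    (hexp : ∀ w ∈ W, (((ringChar F).choose 2 : ℕ) : ZMod (ringChar F)) * phaseForm w w = 0) :
    ∃ s : W →+ Additive (Op F), ∀ w, ∃ c, (s w).toMul = pauliOp c (w : Symbol F) := by
  let _ : CommGroup (symbolGroup W) :=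
    { (inferInstance : Group (symbolGroup W)) with
      mul_comm := fun g h => Subtype.ext (symbolGroup_comm hcomm g.2 h.2) }
  have hF : ∀ x : Symbol F, ringChar F • x = 0 := fun x => by
    rw [← Nat.cast_smul_eq_nsmul F, ringChar.Nat.cast_ringChar, zero_smul]
  have hW : ∀ x : W, ringChar F • x = 0 := fun x => Subtype.ext (hF x)
  -- In the `p`-th power both `p • w` and `p c` vanish, and `hexp` removes the binomial term.
  have hG : ∀ x : Additive (symbolGroup W), ringChar F • x = 0 := fun x => by
    obtain ⟨c, w, hw, h⟩ := x.toMul.2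
    apply Additive.toMul.injective
    refine Subtype.ext ?_
    rw [toMul_nsmul, toMul_zero, Subgroup.coe_pow, h, pauliOp_pow, hF, hexp w hw,
      CharP.cast_eq_zero, zero_mul, add_zero, pauliOp_zero, Subgroup.coe_one]
  choose c w hw h using fun x : Additive (symbolGroup W) => x.toMul.2
  let f : Additive (symbolGroup W) →+ W := AddMonoidHom.mk' (fun x => ⟨w x, hw x⟩) fun x y => by
    refine Subtype.ext ?_
    have := h (x + y)
    rw [toMul_add, Subgroup.coe_mul, h x, h y, pauliOp_mul] at this
    exact (pauliOp_injective this).2.symm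
  have hsurj : Function.Surjective f := by
    intro v
    refine ⟨Additive.ofMul ⟨pauliOp 0 v, ⟨0, v, v.2, rfl⟩⟩, Subtype.ext ?_⟩
    exact (pauliOp_injective (h (Additive.ofMul ⟨pauliOp 0 v, ⟨0, v, v.2, rfl⟩⟩))).2.symm
  obtain ⟨s, hs⟩ := exists_rightInverse_of_nsmul_eq_zero (ringChar F) hG hW f hsurj
  refine ⟨((symbolGroup W).subtype.toAdditive).comp s, fun v => ⟨c (s v), ?_⟩⟩
  have h1 : w (s v) = v := congrArg Subtype.val (hs v)
  rw [← h1]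
  exact h (s v)

/-- Homomorphisms into a commutative group of Pauli operators can be combined. -/
theorem exists_hom_of_single {ι U : Type*} [AddCommGroup U] (W : AddSubgroup (Symbol F))
    (hcomm : ∀ w ∈ W, ∀ w' ∈ W, phaseForm w w' = phaseForm w' w)
    (s : ι → U →+ Additive (Op F)) (Ψ : (ι →₀ U) →+ Symbol F) (hΨ : ∀ u, Ψ u ∈ W)
    (hs : ∀ i u, ∃ c, (s i u).toMul = pauliOp c (Ψ (Finsupp.single i u))) :
    ∃ Φ : (ι →₀ U) →+ Additive (Op F), (∀ i u, Φ (Finsupp.single i u) = s i u) ∧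
      ∀ u, ∃ c, (Φ u).toMul = pauliOp c (Ψ u) := by
  let _ : CommGroup (symbolGroup W) :=
    { (inferInstance : Group (symbolGroup W)) with
      mul_comm := fun g h => Subtype.ext (symbolGroup_comm hcomm g.2 h.2) }
  have hmem : ∀ i u, (s i u).toMul ∈ symbolGroup W := fun i u => by
    obtain ⟨c, hc⟩ := hs i u
    rw [hc]
    exact pauliOp_mem_symbolGroup.2 (hΨ _)
  let s' : ι → U →+ Additive (symbolGroup W) := fun i =>
    AddMonoidHom.mk' (fun u => Additive.ofMul ⟨(s i u).toMul, hmem i u⟩) fun u u' => by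
      apply Additive.toMul.injective
      exact Subtype.ext (congrArg Additive.toMul ((s i).map_add u u'))
  let Φ : (ι →₀ U) →+ Additive (Op F) :=
    ((symbolGroup W).subtype.toAdditive).comp (Finsupp.liftAddHom s')
  have hΦ : ∀ i u, Φ (Finsupp.single i u) = s i u := fun i u => by
    simp only [Φ, AddMonoidHom.comp_apply, Finsupp.liftAddHom_apply_single]
    rfl
  refine ⟨Φ, hΦ, fun u => ?_⟩
  induction u using Finsupp.induction_linear with
  | zero => exact ⟨0, by rw [Φ.map_zero, Ψ.map_zero, pauliOp_zero, toMul_zero]⟩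
  | add u v hu hv =>
    obtain ⟨c, hc⟩ := hu
    obtain ⟨d, hd⟩ := hv
    exact ⟨_, by rw [Φ.map_add, Ψ.map_add, toMul_add, hc, hd, pauliOp_mul]⟩
  | single i u => exact hΦ i u ▸ hs i u

end Lift

/-! ### The bi-infinite encoder with memory one. -/

section Encode

variable {K : Type*} [Field K] {U : Type*} [AddCommGroup U] [Module K U] {n : ℕ}

/-- The blocks of the code sequences: block `l` is `H₀ u_l + H₁ u_{l-1}`. -/
def encode (H₀ H₁ : U →ₗ[K] (Fin n → K)) : (ℤ →₀ U) →ₗ[K] (ℤ →₀ (Fin n → K)) :=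
  Finsupp.mapRange.linearMap H₀ +
    (translateSeq K (Fin n → K) 1).toLinearMap.comp (Finsupp.mapRange.linearMap H₁)

variable (H₀ H₁ : U →ₗ[K] (Fin n → K))

theorem encode_apply (u : ℤ →₀ U) (l : ℤ) : encode H₀ H₁ u l = H₀ (u l) + H₁ (u (l - 1)) := rfl

theorem encode_single (l : ℤ) (u : U) :
    encode H₀ H₁ (Finsupp.single l u) = Finsupp.single l (H₀ u) + Finsupp.single (l + 1) (H₁ u) := by
  ext1 l'
  rw [encode_apply, Finsupp.add_apply]
  congr 1
  · by_cases h : l' = l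
    · subst h; simp
    · rw [Finsupp.single_eq_of_ne h, Finsupp.single_eq_of_ne h, map_zero]
  · by_cases h : l' = l + 1
    · subst h; simp
    · rw [Finsupp.single_eq_of_ne h, Finsupp.single_eq_of_ne (by omega), map_zero]

theorem encode_translateSeq (l : ℤ) (u : ℤ →₀ U) :
    encode H₀ H₁ (translateSeq K U l u) = translateSeq K _ l (encode H₀ H₁ u) := by
  ext1 l'
  rw [encode_apply, translateSeq_apply, translateSeq_apply, translateSeq_apply, encode_apply,
    sub_right_comm]

variable {H₀ H₁}

/-- At the earliest nonzero input the output block has no contribution from `H₁`, so it is `H₀ u_l`.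
-/
theorem eq_zero_of_encode_eq_zero_left (h₀ : Function.Injective H₀) {u : ℤ →₀ U} {A : ℤ}
    (h : ∀ l < A, encode H₀ H₁ u l = 0) : ∀ l < A, u l = 0 := by
  classical
  by_contra! hne
  obtain ⟨l, hl, hul⟩ := hne
  obtain ⟨m, hm, hmin⟩ := Finset.exists_min_image (u.support.filter (· < A)) id
    ⟨l, Finset.mem_filter.2 ⟨Finsupp.mem_support_iff.2 hul, hl⟩⟩
  rw [Finset.mem_filter, Finsupp.mem_support_iff] at hm
  have hprev : u (m - 1) = 0 := by
    by_contra hp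
    have := hmin (m - 1) (Finset.mem_filter.2 ⟨Finsupp.mem_support_iff.2 hp, by omega⟩)
    simp only [id] at this
    omega
  have := h m hm.2
  rw [encode_apply, hprev, map_zero, add_zero] at this
  exact hm.1 ((map_eq_zero_iff _ h₀).1 this)

/-- The last nonzero input `u_l` produces the block `H₁ u_l` at `l + 1`; hence outputs vanishing
beyond `A` force the inputs to vanish from `A` on. -/
theorem eq_zero_of_encode_eq_zero_right (h₁ : Function.Injective H₁) {u : ℤ →₀ U} {A : ℤ}
    (h : ∀ l, A < l → encode H₀ H₁ u l = 0) : ∀ l, A ≤ l → u l = 0 := by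
  classical
  by_contra! hne
  obtain ⟨l, hl, hul⟩ := hne
  obtain ⟨m, hm, hmax⟩ := Finset.exists_max_image (u.support.filter (A ≤ ·)) id
    ⟨l, Finset.mem_filter.2 ⟨Finsupp.mem_support_iff.2 hul, hl⟩⟩
  rw [Finset.mem_filter, Finsupp.mem_support_iff] at hm
  have hnext : u (m + 1) = 0 := by
    by_contra hp
    have := hmax (m + 1) (Finset.mem_filter.2 ⟨Finsupp.mem_support_iff.2 hp, by omega⟩)
    simp only [id] at this
    omega
  have := h (m + 1) (by omega)
  rw [encode_apply, hnext, map_zero, zero_add, add_sub_cancel_right] at this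
  exact hm.1 ((map_eq_zero_iff _ h₁).1 this)

theorem encode_injective (h₀ : Function.Injective H₀) : Function.Injective (encode H₀ H₁) := by
  rw [injective_iff_map_eq_zero]
  intro u hu
  ext1 l
  exact eq_zero_of_encode_eq_zero_left (H₁ := H₁) h₀ (A := l + 1) (fun l _ => by rw [hu]; rfl) l
    (by omega)

end Encode

/-! ### From a self-orthogonal encoder to a convolutional stabilizer code. -/

section Construction

variable {F K : Type*} [Field F] [Fintype F] [Field K] [Fintype K] [Algebra F K]

attribute [local instance] fact_prime_ringChar

local notation "σ" => FiniteField.frobeniusAlgHom F K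

variable {n t : ℕ} [NeZero n]

/-- The symbols of the operators that correspond to the code sequences. -/
def codeSymbol (hK : Fintype.card K = Fintype.card F ^ 2) {β : K}
    (hβ : LinearIndependent F ![β, σ β]) (H₀ H₁ : (Fin t → K) →ₗ[K] (Fin n → K)) :
    (ℤ →₀ (Fin t → K)) →ₗ[F] Symbol F :=
  (tauEquiv hK hβ).symm.toLinearMap.comp
    (((unblock K n).toLinearMap.comp (encode H₀ H₁)).restrictScalars F)

theorem tauSeq_codeSymbol (hK : Fintype.card K = Fintype.card F ^ 2) {β : K}
    (hβ : LinearIndependent F ![β, σ β]) (H₀ H₁ : (Fin t → K) →ₗ[K] (Fin n → K))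
    (u : ℤ →₀ (Fin t → K)) :
    tauSeq β (codeSymbol hK hβ H₀ H₁ u) = unblock K n (encode H₀ H₁ u) :=
  (tauEquiv hK hβ).apply_symm_apply _

theorem translateSymbol_codeSymbol (hK : Fintype.card K = Fintype.card F ^ 2) {β : K}
    (hβ : LinearIndependent F ![β, σ β]) (H₀ H₁ : (Fin t → K) →ₗ[K] (Fin n → K)) (l : ℤ)
    (u : ℤ →₀ (Fin t → K)) :
    translateSymbol F (l * n) (codeSymbol hK hβ H₀ H₁ u) =
      codeSymbol hK hβ H₀ H₁ (translateSeq K _ l u) := by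
  apply tauSeq_injective hβ
  rw [tauSeq_translateSymbol, tauSeq_codeSymbol, tauSeq_codeSymbol, encode_translateSeq,
    translateSeq_unblock]

theorem translateSeq_single {R M : Type*} [Semiring R] [AddCommMonoid M] [Module R M]
    (l i : ℤ) (x : M) :
    translateSeq R M l (Finsupp.single i x) = Finsupp.single (i + l) x := by
  rw [translateSeq, Finsupp.domLCongr_single]
  rfl

theorem codeSymbol_injective (hK : Fintype.card K = Fintype.card F ^ 2) {β : K}
    (hβ : LinearIndependent F ![β, σ β]) {H₀ : (Fin t → K) →ₗ[K] (Fin n → K)}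
    (H₁ : (Fin t → K) →ₗ[K] (Fin n → K)) (h₀ : Function.Injective H₀) :
    Function.Injective (codeSymbol hK hβ H₀ H₁) := fun u v h =>
  encode_injective (H₁ := H₁) h₀ ((unblock K n).injective (by
    rw [← tauSeq_codeSymbol hK hβ, h, tauSeq_codeSymbol]))

/-- A pair of injective linear maps with values in a Hermitian self-orthogonal space of words with
sum zero defines a convolutional stabilizer code. -/
theorem exists_convStabCode (hK : Fintype.card K = Fintype.card F ^ 2) {β : K}
    (hβ : LinearIndependent F ![β, σ β]) {H₀ H₁ : (Fin t → K) →ₗ[K] (Fin n → K)}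
    (h₀ : Function.Injective H₀) (R : Submodule K (Fin n → K))
    (hR₀ : ∀ u, H₀ u ∈ R) (hR₁ : ∀ u, H₁ u ∈ R)
    (hherm : ∀ r ∈ R, ∀ r' ∈ R, ∑ i, r i * σ (r' i) = 0) (hsum : ∀ r ∈ R, ∑ i, r i = 0)
    (ht : 2 * t ≤ n) :
    ∃ (Q : ConvStabCode F n (n - 2 * t) n) (Φ : (ℤ →₀ (Fin t → K)) →+ Additive (Op F)),
      (∀ u, ∃ c, (Φ u).toMul = pauliOp c (codeSymbol hK hβ H₀ H₁ u)) ∧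
      (∀ g, g ∈ Q.S₀ ↔ ∃ u, g = (Φ (Finsupp.single 0 u)).toMul) ∧
      (∀ g, g ∈ Q.stabilizer ↔ ∃ u, g = (Φ u).toMul) := by
  set Ψ := codeSymbol hK hβ H₀ H₁
  have hblock : ∀ u l, encode H₀ H₁ u l ∈ R := fun u l => R.add_mem (hR₀ _) (hR₁ _)
  have hhermΨ : ∀ u v, herm F (tauSeq β (Ψ u)) (tauSeq β (Ψ v)) = 0 := by
    intro u v
    rw [tauSeq_codeSymbol, tauSeq_codeSymbol, herm_unblock]
    exact Finset.sum_eq_zero fun l _ => hherm _ (hblock u l) _ (hblock v l)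
  set W : AddSubgroup (Symbol F) := Ψ.toAddMonoidHom.range
  have hcomm : ∀ w ∈ W, ∀ w' ∈ W, phaseForm w w' = phaseForm w' w := by
    rintro _ ⟨u, rfl⟩ _ ⟨v, rfl⟩
    exact phaseForm_comm_of_herm_eq_zero hK hβ (hhermΨ u v)
  have hexp : ∀ w ∈ W,
      (((ringChar F).choose 2 : ℕ) : ZMod (ringChar F)) * phaseForm w w = 0 := by
    rintro _ ⟨u, rfl⟩
    refine choose_mul_phaseForm_self hK hβ (hhermΨ u u) ?_
    change (tauSeq β (Ψ u)).sum _ = 0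
    rw [tauSeq_codeSymbol, sum_unblock _ _ fun _ => rfl]
    exact Finset.sum_eq_zero fun l _ => hsum _ (hblock u l)
  obtain ⟨s, hs⟩ := exists_section W hcomm hexp
  -- Only the phases for inputs at time `0` are taken from `s`, which need not respect shifts. The
  -- phases at other times are obtained by translation, since the stabilizer is generated by shifts
  -- of `S_0`.
  let s₀ : (Fin t → K) →+ Additive (Op F) :=
    s.comp ((Ψ.toAddMonoidHom.rangeRestrict).comp (Finsupp.singleAddHom (0 : ℤ)))
  have hs₀ : ∀ u, ∃ c, (s₀ u).toMul = pauliOp c (Ψ (Finsupp.single 0 u)) := fun u => hs _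
  obtain ⟨Φ, hΦs, hΦ⟩ := exists_hom_of_single W hcomm
    (fun l : ℤ => ((shift F (l * n)).toAdditive).comp s₀) Ψ.toAddMonoidHom (fun u => ⟨u, rfl⟩) (by
      intro l u
      obtain ⟨c, hc⟩ := hs₀ u
      refine ⟨c, ?_⟩
      change shift F (l * n) (s₀ u).toMul = pauliOp c (Ψ (Finsupp.single l u))
      rw [hc, shift_pauliOp, translateSymbol_codeSymbol, translateSeq_single, zero_add])
  have hΦ' : ∀ u, ∃ c, (Φ u).toMul = pauliOp c (Ψ u) := hΦ
  have hΦshift : ∀ (l : ℤ) u, (Φ (Finsupp.single l u)).toMul =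
      shift F (l * n) (Φ (Finsupp.single 0 u)).toMul := by
    intro l u
    have h1 : (Φ (Finsupp.single 0 u)).toMul = shift F ((0 : ℤ) * n) (s₀ u).toMul := by
      rw [hΦs]; rfl
    have h2 : (Φ (Finsupp.single l u)).toMul = shift F (l * n) (s₀ u).toMul := by
      rw [hΦs]; rfl
    obtain ⟨c, hc⟩ := hs₀ u
    rw [h1, h2, hc, shift_pauliOp, shift_pauliOp, shift_pauliOp, translateSymbol_codeSymbol,
      translateSymbol_codeSymbol, translateSymbol_codeSymbol, translateSeq_single,
      translateSeq_single, translateSeq_single, zero_add, zero_add, zero_add]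
  let A : Set ℤ → Subgroup (Op F) := fun I =>
    AddSubgroup.toSubgroup' ((Finsupp.supported (Fin t → K) F I).toAddSubgroup.map Φ)
  have hA : ∀ I g, g ∈ A I ↔ ∃ u ∈ Finsupp.supported (Fin t → K) F I, (Φ u).toMul = g :=
    fun I g => Iff.rfl
  have hAW : ∀ I, A I ≤ symbolGroup W := by
    rintro I _ ⟨u, -, rfl⟩
    obtain ⟨c, hc⟩ := hΦ' u
    exact ⟨c, _, ⟨u, rfl⟩, hc⟩
  have hsingle : ∀ (l : ℤ) g, g ∈ A {l} ↔ ∃ u, (Φ (Finsupp.single l u)).toMul = g := by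
    intro l g
    rw [hA]
    constructor
    · rintro ⟨u, hu, rfl⟩
      refine ⟨u l, ?_⟩
      congr 2
      exact (Finsupp.support_subset_singleton.1 fun x hx => Finset.mem_singleton.2 (hu hx)).symm
    · rintro ⟨u, rfl⟩
      exact ⟨_, Finsupp.single_mem_supported F u rfl, rfl⟩
  have hmap : ∀ l : ℤ, (A {0}).map (shift F (l * n)) = A {l} := by
    intro l
    ext g
    rw [Subgroup.mem_map, hsingle]
    constructor
    · rintro ⟨g, hg, rfl⟩
      obtain ⟨u, rfl⟩ := (hsingle 0 g).1 hg
      exact ⟨u, hΦshift l u⟩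
    · rintro ⟨u, rfl⟩
      exact ⟨_, (hsingle 0 _).2 ⟨u, rfl⟩, (hΦshift l u).symm⟩
  have hstep : ∀ T : ℕ, stabStep n (A {0}) T = A (Set.Icc 0 (T : ℤ)) := by
    intro T
    induction T with
    | zero => simp [stabStep]
    | succ T ih =>
      have hI : Set.Icc (0 : ℤ) ((T + 1 : ℕ) : ℤ) = Set.Icc 0 (T : ℤ) ∪ {((T + 1 : ℕ) : ℤ)} := by
        ext l
        simp only [Set.mem_Icc, Set.mem_union, Set.mem_singleton_iff]
        omega
      have hl : (((T + 1) * n : ℕ) : ℤ) = ((T + 1 : ℕ) : ℤ) * n := by push_cast; ring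
      rw [stabStep, ih, hl, hmap, hI]
      simp only [A, Finsupp.supported_union, Submodule.sup_toAddSubgroup, AddSubgroup.map_sup,
        map_sup]
  -- This yields (S3): a scalar in the image of `Φ` has zero symbol, injectivity of `Ψ` makes its
  -- input zero, and a homomorphism sends that to `1`.
  have hone : ∀ u, Ψ u = 0 → (Φ u).toMul = 1 := by
    intro u hu
    rw [(map_eq_zero_iff Ψ (codeSymbol_injective hK hβ H₁ h₀)).1 hu, map_zero, toMul_zero]
  let Q : ConvStabCode F n (n - 2 * t) n :=
    { S₀ := A {0}
      le_pauli := by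
        intro g hg
        obtain ⟨u, rfl⟩ := (hsingle 0 g).1 hg
        obtain ⟨c, hc⟩ := hΦ' (Finsupp.single 0 u)
        rw [hc]
        have hn : 0 < n := NeZero.pos n
        -- An input at time `0` affects the blocks `0` and `1` only, hence `2n` qudits: this is
        -- where `m = n` comes from.
        have hn2 : (((0 + 1) * n + n : ℕ) : ℤ) = 2 * n := by push_cast; ring
        rw [pauliStep, hn2]
        refine pauliOp_mem_pauliGroup ⟨0, by rw [Set.mem_Ico]; omega⟩ c ?_
        intro N hN
        by_contra hne
        rw [not_and_or, ← tauSeq_ne_zero_iff hβ, tauSeq_codeSymbol] at hne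
        obtain ⟨l, i, rfl⟩ := exists_eq_mul_add n N
        rw [unblock_apply, encode_single, Finsupp.add_apply] at hne
        have hl : l = 0 ∨ l = 1 := by
          by_contra! hl
          rw [Finsupp.single_eq_of_ne hl.1, Finsupp.single_eq_of_ne (show l ≠ 0 + 1 from hl.2)] at hne
          exact hne (add_zero _)
        apply hN
        have := i.2
        rw [Set.mem_Ico]
        rcases hl with rfl | rfl <;> omega
      abelian := fun M hM N hN => symbolGroup_comm hcomm (hAW _ hM) (hAW _ hN)
      k_le := Nat.sub_le _ _
      shift_comm := by
        intro T _ M hM N hN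
        refine symbolGroup_comm hcomm (hAW {(T : ℤ)} ?_) (hAW _ hN)
        rw [← hmap, Nat.cast_mul]
        exact Subgroup.mem_map_of_mem _ hM
      dim_eq := by
        intro T
        refine ⟨(Finsupp.supported (Fin t → K) F (Set.Icc 0 (T : ℤ))).map Ψ, fun a b => ?_, ?_⟩
        · rw [hstep, Submodule.mem_map]
          constructor
          · rintro ⟨u, hu, h⟩
            obtain ⟨c, hc⟩ := hΦ' u
            exact ⟨_, (hA _ _).2 ⟨u, hu, rfl⟩, isSymbol_iff.2 ⟨c, by rw [hc, h]⟩⟩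
          · rintro ⟨g, hg, hab⟩
            obtain ⟨u, hu, rfl⟩ := (hA _ _).1 hg
            obtain ⟨c, hc⟩ := hΦ' u
            obtain ⟨d, hd⟩ := isSymbol_iff.1 hab
            exact ⟨u, hu, (pauliOp_injective (hc.symm.trans hd)).2⟩
        · have hfin : Module.finrank F K = 2 := by
            have := Module.card_eq_pow_finrank (K := F) (V := K)
            rw [hK] at this
            exact (Nat.pow_right_injective Fintype.one_lt_card this).symm
          rw [← (Submodule.equivMapOfInjective Ψ (codeSymbol_injective hK hβ H₁ h₀) _).finrank_eq,
            (Finsupp.supportedEquivFinsupp _).finrank_eq,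
            (Finsupp.linearEquivFunOnFinite F (Fin t → K) (Set.Icc 0 (T : ℤ))).finrank_eq,
            Module.finrank_pi_fintype, Finset.sum_const, Module.finrank_pi_fintype,
            Finset.card_univ]
          simp only [hfin, Finset.sum_const, Finset.card_univ, Fintype.card_fin, smul_eq_mul]
          have h1 : Fintype.card (Set.Icc 0 (T : ℤ)) = T + 1 := by
            have := Int.card_fintype_Icc_of_le 0 (T : ℤ) (by omega)
            omega
          have h2 : n - (n - 2 * t) = t * 2 := by omega
          rw [h1, h2]
      center_trivial := by
        intro T
        rw [eq_bot_iff]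
        rintro g ⟨hg, hc⟩
        rw [hstep] at hg
        obtain ⟨u, -, rfl⟩ := (hA _ _).1 hg
        obtain ⟨c, hu⟩ := hΦ' u
        have := centerOf_pauliGroup_le _ hc
        rw [hu, pauliOp_mem_symbolGroup, AddSubgroup.mem_bot] at this
        exact Subgroup.mem_bot.2 (hone u this) }
  refine ⟨Q, Φ, hΦ', fun g => ?_, fun g => ?_⟩
  · exact (hsingle 0 g).trans ⟨fun ⟨u, h⟩ => ⟨u, h.symm⟩, fun ⟨u, h⟩ => ⟨u, h.symm⟩⟩
  · have hstab : Q.stabilizer = ⨆ l : ℤ, A {l} := iSup_congr hmap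
    rw [hstab]
    constructor
    · intro hg
      have hle : ⨆ l : ℤ, A {l} ≤ A Set.univ := iSup_le fun l => by
        rintro _ ⟨u, -, rfl⟩
        exact (hA _ _).2 ⟨u, (Finsupp.mem_supported _ _).2 (Set.subset_univ _), rfl⟩
      obtain ⟨u, -, rfl⟩ := (hA _ _).1 (hle hg)
      exact ⟨u, rfl⟩
    · rintro ⟨u, rfl⟩
      induction u using Finsupp.induction_linear with
      | zero => rw [Φ.map_zero]; exact one_mem _
      | add u v hu hv => rw [Φ.map_add]; exact mul_mem hu hv
      | single l u => exact Subgroup.mem_iSup_of_mem l ((hsingle l _).2 ⟨u, rfl⟩)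

end Construction

/-! ### Lower and upper bounds for Hamming weights. -/

section Weights

variable {K : Type*} [Field K]

open scoped Classical in
/-- The Hamming weight of a word. -/
def wt {n : ℕ} (r : Fin n → K) : ℕ := (Finset.univ.filter fun i => r i ≠ 0).card

theorem card_support_unblock {n : ℕ} [NeZero n] (f : ℤ →₀ (Fin n → K)) :
    (unblock K n f).support.card = f.sum fun _ r => wt r := by
  classical
  have h : (unblock K n f).support.card = (unblock K n f).sum fun _ y => if y ≠ 0 then 1 else 0 := by
    rw [Finsupp.sum, Finset.card_eq_sum_ones]
    exact Finset.sum_congr rfl fun i hi => (if_pos (Finsupp.mem_support_iff.1 hi)).symm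
  rw [h, sum_unblock _ _ fun _ => by simp]
  refine Finset.sum_congr rfl fun l _ => ?_
  dsimp only
  rw [Finset.sum_boole, wt, Nat.cast_id]

/-- A nonzero word that is orthogonal to the first `N` rows of a Vandermonde matrix has weight
greater than `N`. -/
theorem lt_wt_of_vandermonde {n N : ℕ} {x : Fin n → K} (hx : Function.Injective x)
    {r : Fin n → K} (hr : r ≠ 0) (h : ∀ k < N, ∑ i, r i * x i ^ k = 0) : N < wt r := by
  classical
  by_contra! hle
  obtain ⟨i₀, hi₀⟩ := Function.ne_iff.1 hr
  set s := Finset.univ.filter fun i => r i ≠ 0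
  have hi₀s : i₀ ∈ s := Finset.mem_filter.2 ⟨Finset.mem_univ _, hi₀⟩
  -- `P` vanishes at all locators of the support except that of `i₀`. As its degree is below `N`,
  -- orthogonality gives `∑ r i * P (x i) = 0`, and only the nonzero term at `i₀` survives.
  set P : K[X] := ∏ i ∈ s.erase i₀, (X - C (x i))
  have hdeg : P.natDegree < N := by
    rw [natDegree_prod_of_monic _ _ fun i _ => monic_X_sub_C _]
    simp only [natDegree_X_sub_C, Finset.sum_const, smul_eq_mul, mul_one]
    exact (Finset.card_erase_lt_of_mem hi₀s).trans_le (by simpa only [wt, s] using! hle)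
  have h0 : ∑ i, r i * P.eval (x i) = 0 := by
    simp only [eval_eq_sum_range, Finset.mul_sum]
    rw [Finset.sum_comm]
    refine Finset.sum_eq_zero fun k hk => ?_
    have := h k (by rw [Finset.mem_range] at hk; omega)
    calc ∑ i, r i * (P.coeff k * x i ^ k) = P.coeff k * ∑ i, r i * x i ^ k := by
          rw [Finset.mul_sum]
          exact Finset.sum_congr rfl fun i _ => by ring
      _ = 0 := by rw [this, mul_zero]
  rw [Finset.sum_eq_single i₀] at h0
  · rcases mul_eq_zero.1 h0 with h0 | h0
    · exact hi₀ h0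
    · rw [eval_prod, Finset.prod_eq_zero_iff] at h0
      obtain ⟨i, hi, h0⟩ := h0
      rw [eval_sub, eval_X, eval_C, sub_eq_zero] at h0
      exact (Finset.mem_erase.1 hi).1 (hx h0).symm
  · intro i _ hi
    by_cases hri : r i = 0
    · rw [hri, zero_mul]
    · have : P.eval (x i) = 0 := by
        rw [eval_prod]
        refine Finset.prod_eq_zero (i := i) (Finset.mem_erase.2 ⟨hi, ?_⟩) (by simp)
        exact Finset.mem_filter.2 ⟨Finset.mem_univ _, hri⟩
      rw [this, mul_zero]
  · exact fun h => absurd (Finset.mem_univ _) h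

/-- Fewer than `n` linear conditions have a solution of small weight. -/
theorem exists_wt_le {n : ℕ} {ι : Type*} [Fintype ι] (c : ι → Fin n → K)
    (hn : Fintype.card ι < n) :
    ∃ r : Fin n → K, r ≠ 0 ∧ (∀ k, ∑ i, c k i * r i = 0) ∧ wt r ≤ Fintype.card ι + 1 := by
  classical
  obtain ⟨s, -, hs⟩ := Finset.exists_subset_card_eq (s := (Finset.univ : Finset (Fin n)))
    (n := Fintype.card ι + 1) (by rw [Finset.card_univ, Fintype.card_fin]; omega)
  -- The extra rows force the word to vanish outside a set of `|ι| + 1` positions; in total there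
  -- are `n - 1` conditions on `n` unknowns.
  let M : Matrix (ι ⊕ (sᶜ : Finset (Fin n))) (Fin n) K :=
    Matrix.of (Sum.elim c fun j => Pi.single (j : Fin n) 1)
  have hker : LinearMap.ker M.mulVecLin ≠ ⊥ := by
    refine LinearMap.ker_ne_bot_of_finrank_lt ?_
    rw [Module.finrank_fintype_fun_eq_card, Module.finrank_fintype_fun_eq_card, Fintype.card_sum,
      Fintype.card_coe, Finset.card_compl, hs, Fintype.card_fin]
    omega
  obtain ⟨r, hr, hr0⟩ := (Submodule.ne_bot_iff _).1 hker
  rw [LinearMap.mem_ker, Matrix.mulVecLin_apply] at hr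
  refine ⟨r, hr0, fun k => congrFun hr (Sum.inl k), ?_⟩
  rw [← hs]
  refine Finset.card_le_card fun i hi => ?_
  by_contra his
  have := congrFun hr (Sum.inr ⟨i, Finset.mem_compl.2 his⟩)
  simp only [M, Matrix.mulVec, dotProduct, Matrix.of_apply, Sum.elim_inr, Pi.zero_apply] at this
  rw [Finset.sum_eq_single i (fun j _ hj => by rw [Pi.single_eq_of_ne hj, zero_mul])
    (fun h => absurd (Finset.mem_univ _) h), Pi.single_eq_same, one_mul] at this
  exact (Finset.mem_filter.1 hi).2 this

end Weights

/-! ### Words of powers of a root of unity and the distance of the dual code. -/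

section Roots

variable {K : Type*} [Field K]

/-- The word `(a ^ (e * i))`, `0 ≤ i < n`. -/
def rowVec (a : K) (n : ℕ) (e : ℤ) : Fin n → K := fun i => (a ^ e) ^ (i : ℕ)

theorem rowVec_mul {a : K} (ha : a ≠ 0) {n : ℕ} (e e' : ℤ) (i : Fin n) :
    rowVec a n e i * rowVec a n e' i = rowVec a n (e + e') i := by
  rw [rowVec, rowVec, rowVec, ← mul_pow, zpow_add₀ ha]

theorem sum_rowVec {a : K} {n : ℕ} (ha : IsPrimitiveRoot a n) {e : ℤ} (he : ¬ (n : ℤ) ∣ e) :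
    ∑ i, rowVec a n e i = 0 := by
  have h1 : a ^ e ≠ 1 := fun h => he ((ha.zpow_eq_one_iff_dvd e).1 h)
  have h2 : (a ^ e) ^ n = 1 := by
    rw [← zpow_natCast, ← zpow_mul, mul_comm, zpow_mul, zpow_natCast, ha.pow_eq_one, one_zpow]
  simp only [rowVec]
  rw [Fin.sum_univ_eq_sum_range (fun i => (a ^ e) ^ i) n, geom_sum_eq h1, h2, sub_self, zero_div]

theorem rowVec_inv (a : K) (n : ℕ) (e : ℤ) : rowVec a⁻¹ n e = rowVec a n (-e) := by
  funext i
  rw [rowVec, rowVec, inv_zpow']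

/-- For odd `n` the square of a primitive root is again primitive. This makes steps of `2` in the
exponents as good as steps of `1`. -/
theorem sq_rowVec_injective {a : K} {n : ℕ} (ha : IsPrimitiveRoot a n) (hn : Odd n) :
    Function.Injective fun i : Fin n => (a ^ 2) ^ (i : ℕ) := by
  have h2 : IsPrimitiveRoot (a ^ 2) n := ha.pow_of_coprime 2 (Nat.coprime_two_left.2 hn)
  intro i j h
  exact Fin.ext (h2.pow_inj i.2 j.2 h)

/-- A nonzero word orthogonal to `N` rows with exponents in arithmetic progression with difference
`2` has weight greater than `N`. -/
theorem lt_wt_of_rowVec {a : K} {n : ℕ} [NeZero n] (ha : IsPrimitiveRoot a n) (hn : Odd n)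
    {r : Fin n → K} (hr : r ≠ 0) (N : ℕ) (e : ℤ)
    (h : ∀ k < N, ∑ i, r i * rowVec a n (e + 2 * (k : ℕ)) i = 0) : N < wt r := by
  have ha0 : a ≠ 0 := ha.ne_zero (NeZero.ne n)
  have hrow : ∀ (e : ℤ) (i : Fin n), rowVec a n e i ≠ 0 := fun e i =>
    pow_ne_zero _ (zpow_ne_zero _ ha0)
  -- Absorbing the nonzero entries of the row with exponent `e` into `r` preserves the weight and
  -- leaves the powers of the distinct locators `a^(2i)`.
  have hwt : wt (fun i => r i * rowVec a n e i) = wt r := by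
    rw [wt, wt]
    congr 1
    ext i
    simp [hrow]
  rw [← hwt]
  refine lt_wt_of_vandermonde (sq_rowVec_injective ha hn) ?_ ?_
  · intro h0
    refine hr (funext fun i => ?_)
    exact (mul_eq_zero.1 (congrFun h0 i)).resolve_right (hrow e i)
  · intro k hk
    rw [← h k hk]
    refine Finset.sum_congr rfl fun i _ => ?_
    rw [← rowVec_mul ha0, mul_assoc]
    congr 2
    rw [rowVec, ← pow_mul, ← pow_mul, ← zpow_natCast, ← zpow_natCast, ← zpow_mul]
    congr 1
    push_cast
    ring

/-- The words orthogonal to Piret's code have weight at least `2 * t + 1`. -/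
theorem le_card_support_of_orthogonal {a : K} {n : ℕ} [NeZero n] (ha : IsPrimitiveRoot a n)
    (hn : Odd n) {t : ℕ} {f : ℤ →₀ (Fin n → K)} (hf : f ≠ 0)
    (h : ∀ l, ∀ j < t, ∑ i, f l i * rowVec a n (2 * (j : ℕ) + 1) i +
      ∑ i, f (l + 1) i * rowVec a n (-(2 * (j : ℕ) + 1)) i = 0) :
    2 * t + 1 ≤ (unblock K n f).support.card := by
  rw [card_support_unblock]
  have hne : f.support.Nonempty := Finsupp.support_nonempty_iff.2 hf
  obtain ⟨l₀, hl₀, hmin⟩ := Finset.exists_min_image f.support id hne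
  obtain ⟨l₁, hl₁, hmax⟩ := Finset.exists_max_image f.support id hne
  have hprev : f (l₀ - 1) = 0 := by
    by_contra hp
    have := hmin _ (Finsupp.mem_support_iff.2 hp)
    simp only [id] at this
    omega
  have hnext : f (l₁ + 1) = 0 := by
    by_contra hp
    have := hmax _ (Finsupp.mem_support_iff.2 hp)
    simp only [id] at this
    omega
  -- Each relation couples two consecutive blocks. Just before the first nonzero block only its
  -- negative exponents remain; at the last block only the positive ones do.
  have h₀ : ∀ j < t, ∑ i, f l₀ i * rowVec a n (-(2 * (j : ℕ) + 1)) i = 0 := by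
    intro j hj
    have := h (l₀ - 1) j hj
    rwa [hprev, sub_add_cancel, Finset.sum_eq_zero (fun i _ => by rw [Pi.zero_apply, zero_mul]),
      zero_add] at this
  have h₁ : ∀ j < t, ∑ i, f l₁ i * rowVec a n (2 * (j : ℕ) + 1) i = 0 := by
    intro j hj
    have := h l₁ j hj
    rwa [hnext, Finset.sum_eq_zero (s := Finset.univ)
      (f := fun i => (0 : Fin n → K) i * rowVec a n (-(2 * (j : ℕ) + 1)) i)
      (fun i _ => by rw [Pi.zero_apply, zero_mul]), add_zero] at this
  rw [Finsupp.mem_support_iff] at hl₀ hl₁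
  -- A single block is orthogonal to all odd exponents from `-(2t - 1)` to `2t - 1`, a progression
  -- of length `2t`. Two distinct end blocks each see a progression of length `t`, for a total
  -- weight of at least `2t + 2`.
  by_cases hll : l₀ = l₁
  · subst hll
    have hlt : 2 * t < wt (f l₀) := by
      refine lt_wt_of_rowVec ha hn hl₀ (2 * t) (-(2 * (t : ℤ) - 1)) fun k hk => ?_
      by_cases hkt : k < t
      · have he : -(2 * (t : ℤ) - 1) + 2 * (k : ℕ) = -(2 * ((t - 1 - k : ℕ) : ℤ) + 1) := by omega
        rw [he]
        exact h₀ _ (by omega)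
      · have he : -(2 * (t : ℤ) - 1) + 2 * (k : ℕ) = 2 * ((k - t : ℕ) : ℤ) + 1 := by omega
        rw [he]
        exact h₁ _ (by omega)
    exact hlt.trans_le (Finset.single_le_sum (f := fun l => wt (f l)) (fun _ _ => Nat.zero_le _)
      (Finsupp.mem_support_iff.2 hl₀))
  · have hlt₀ : t < wt (f l₀) := by
      refine lt_wt_of_rowVec ha hn hl₀ t (-(2 * (t : ℤ) - 1)) fun k hk => ?_
      have he : -(2 * (t : ℤ) - 1) + 2 * (k : ℕ) = -(2 * ((t - 1 - k : ℕ) : ℤ) + 1) := by omega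
      rw [he]
      exact h₀ _ (by omega)
    have hlt₁ : t < wt (f l₁) := by
      refine lt_wt_of_rowVec ha hn hl₁ t 1 fun k hk => ?_
      rw [add_comm]
      exact h₁ k hk
    have hle : ∑ l ∈ {l₀, l₁}, wt (f l) ≤ f.sum fun _ r => wt r := by
      refine Finset.sum_le_sum_of_subset fun l hl => ?_
      rw [Finset.mem_insert, Finset.mem_singleton] at hl
      rw [Finsupp.mem_support_iff]
      rcases hl with rfl | rfl <;> assumption
    rw [Finset.sum_pair hll] at hle
    omega

end Roots

/-! ### Polynomial tuples as sequences of blocks. -/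

section Interleave

variable {K : Type*} [Field K] {n t : ℕ} [NeZero n]

theorem interleave_apply (u : Fin n → K[X]) (l : ℤ) (i : Fin n) :
    interleave u (l * n + i) = if 0 ≤ l then (u i).coeff l.toNat else 0 := by
  have hi := i.2
  rw [interleave]
  by_cases hl : 0 ≤ l
  · obtain ⟨k, rfl⟩ := Int.eq_ofNat_of_zero_le hl
    have hN : ((k : ℤ) * n + i).toNat = k * n + i := by
      rw [← Nat.cast_mul, ← Nat.cast_add, Int.toNat_natCast]
    rw [if_pos (by positivity), if_pos hl, hN, finsetSum_coeff, Int.toNat_natCast,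
      Finset.sum_eq_single i]
    · rw [coeff_X_pow_mul, mul_comm k, coeff_expand_mul' (NeZero.pos n)]
    · intro j _ hj
      have hj2 := j.2
      rw [coeff_X_pow_mul']
      split_ifs with hle
      · rw [coeff_expand (NeZero.pos n), if_neg]
        rintro ⟨d, hd⟩
        refine hj (Fin.ext ?_)
        have h1 : k * n + i = n * d + j := by omega
        have h2 := congrArg (· % n) h1
        rw [mul_comm k, Nat.mul_add_mod, Nat.mul_add_mod, Nat.mod_eq_of_lt hi,
          Nat.mod_eq_of_lt hj2] at h2
        exact h2.symm
      · rfl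
    · exact fun h => absurd (Finset.mem_univ _) h
  · rw [if_neg hl, if_neg]
    push Not at hl ⊢
    have : l * n ≤ -1 * n := mul_le_mul_of_nonneg_right (by omega) (by positivity)
    omega

theorem exists_seq_of_polynomials (w : Fin t → K[X]) :
    ∃ f : ℤ →₀ (Fin t → K), (∀ l < 0, f l = 0) ∧ ∀ (k : ℕ) j, f k j = (w j).coeff k := by
  classical
  refine ⟨Finsupp.onFinset ((Finset.univ.biUnion fun j => (w j).support).map Nat.castEmbedding)
    (fun l => if 0 ≤ l then fun j => (w j).coeff l.toNat else 0) ?_, ?_, ?_⟩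
  · intro l hl
    by_cases h0 : 0 ≤ l
    · obtain ⟨k, rfl⟩ := Int.eq_ofNat_of_zero_le h0
      rw [if_pos h0, Int.toNat_natCast] at hl
      obtain ⟨j, hj⟩ := Function.ne_iff.1 hl
      exact Finset.mem_map.2 ⟨k, Finset.mem_biUnion.2 ⟨j, Finset.mem_univ _, mem_support_iff.2 hj⟩,
        rfl⟩
    · rw [if_neg h0] at hl
      exact absurd rfl hl
  · intro l hl
    rw [Finsupp.onFinset_apply, if_neg (by omega)]
  · intro k j
    rw [Finsupp.onFinset_apply, if_pos (by positivity), Int.toNat_natCast]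

theorem exists_polynomials_of_seq (f : ℤ →₀ (Fin t → K)) (hf : ∀ l < 0, f l = 0) :
    ∃ w : Fin t → K[X], ∀ (k : ℕ) j, f k j = (w j).coeff k := by
  classical
  refine ⟨fun j => ∑ l ∈ f.support, monomial l.toNat (f l j), fun k j => ?_⟩
  simp only [finsetSum_coeff, coeff_monomial]
  rw [Finset.sum_eq_single (k : ℤ), if_pos (Int.toNat_natCast k)]
  · intro l hl hlk
    refine if_neg fun h => hlk ?_
    have : ¬ l < 0 := fun h0 => Finsupp.mem_support_iff.1 hl (hf l h0)
    omega
  · intro h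
    rw [Finsupp.notMem_support_iff.1 h]
    simp

end Interleave

/-! ### The Reed–Solomon convolutional code. -/

section Piret

variable {K : Type*} [Field K] {n t : ℕ}

/-- The matrix `(a ^ ((2 * j + 1) * i))`. -/
def rowMatrix (a : K) (n t : ℕ) : Matrix (Fin t) (Fin n) K :=
  Matrix.of fun j i => a ^ ((2 * (j : ℕ) + 1) * (i : ℕ))

theorem rowMatrix_apply (a : K) (j : Fin t) (i : Fin n) :
    rowMatrix a n t j i = rowVec a n (2 * (j : ℕ) + 1) i := by
  rw [rowMatrix, Matrix.of_apply, rowVec, pow_mul]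
  congr 1
  exact_mod_cast (zpow_natCast a (2 * (j : ℕ) + 1)).symm

theorem rowMatrix_inv_apply (a : K) (j : Fin t) (i : Fin n) :
    rowMatrix a⁻¹ n t j i = rowVec a n (-(2 * (j : ℕ) + 1)) i := by
  rw [rowMatrix_apply, rowVec_inv]

theorem piretMatrix_eq (a : K) (n t : ℕ) :
    piretMatrix a n t = (rowMatrix a n t).map C + (X : K[X]) • (rowMatrix a⁻¹ n t).map C := by
  refine Matrix.ext fun j i => ?_
  rw [Matrix.add_apply, Matrix.smul_apply, Matrix.map_apply, Matrix.map_apply, smul_eq_mul, X_mul_C]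
  rfl

/-- The linear map `u ↦ u H` for the matrix `H = (a ^ ((2 * j + 1) * i))`. -/
def rowMap (a : K) (n t : ℕ) : (Fin t → K) →ₗ[K] (Fin n → K) := (rowMatrix a n t).vecMulLinear

theorem rowMap_apply (a : K) (u : Fin t → K) (i : Fin n) :
    rowMap a n t u i = ∑ j, u j * rowMatrix a n t j i := rfl

theorem not_dvd_of_abs_lt {n : ℕ} {e : ℤ} (h0 : e ≠ 0) (h : |e| < n) : ¬ (n : ℤ) ∣ e :=
  fun hd => h0 (Int.eq_zero_of_abs_lt_dvd hd h)

/-- The entries are geometric sums with exponents `2(j - j')`, smaller than `n` in absolute value,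
so only the diagonal ones are nonzero and they equal `n`. -/
theorem rowMatrix_mul_inv_transpose {a : K} (ha : IsPrimitiveRoot a n) (hn : (n : K) ≠ 0)
    (ht : 2 * t ≤ n) :
    rowMatrix a n t * ((n : K)⁻¹ • (rowMatrix a⁻¹ n t).transpose) = 1 := by
  have hn0 : n ≠ 0 := by rintro rfl; exact hn Nat.cast_zero
  ext j j'
  rw [Matrix.mul_smul, Matrix.smul_apply, Matrix.mul_apply, smul_eq_mul]
  have h : ∀ i, rowMatrix a n t j i * (rowMatrix a⁻¹ n t).transpose i j' =
      rowVec a n (2 * (j : ℕ) - 2 * (j' : ℕ)) i := fun i => by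
    rw [Matrix.transpose_apply, rowMatrix_apply, rowMatrix_inv_apply, rowVec_mul (ha.ne_zero hn0)]
    congr 1
    ring
  rw [Finset.sum_congr rfl fun i _ => h i]
  by_cases hj : j = j'
  · subst hj
    rw [Matrix.one_apply_eq, sub_self]
    have h1 : rowVec a n 0 = fun _ => 1 := funext fun i => by rw [rowVec, zpow_zero, one_pow]
    rw [h1, Finset.sum_const, Finset.card_univ, Fintype.card_fin, nsmul_eq_mul, mul_one,
      inv_mul_cancel₀ hn]
  · have hj' : (j : ℕ) ≠ j' := fun h => hj (Fin.ext h)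
    have h1 := j.2
    have h2 := j'.2
    rw [Matrix.one_apply_ne hj, sum_rowVec ha (not_dvd_of_abs_lt (by omega) ?_), mul_zero]
    rw [abs_lt]
    constructor <;> omega

/-- The exponents `2(j + j' + 1)` lie strictly between `0` and `4t ≤ n`. Applied to `a⁻¹`, this
cancels the `D`-term in the product of the generator matrix with its right inverse. -/
theorem rowMatrix_mul_transpose {a : K} (ha : IsPrimitiveRoot a n) (hn : (n : K) ≠ 0)
    (ht : 4 * t ≤ n) : rowMatrix a n t * (rowMatrix a n t).transpose = 0 := by
  have hn0 : n ≠ 0 := by rintro rfl; exact hn Nat.cast_zero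
  ext j j'
  rw [Matrix.mul_apply, Matrix.zero_apply]
  have h : ∀ i, rowMatrix a n t j i * (rowMatrix a n t).transpose i j' =
      rowVec a n (2 * (j : ℕ) + 1 + (2 * (j' : ℕ) + 1)) i := fun i => by
    rw [Matrix.transpose_apply, rowMatrix_apply, rowMatrix_apply, rowVec_mul (ha.ne_zero hn0)]
  have h1 := j.2
  have h2 := j'.2
  rw [Finset.sum_congr rfl fun i _ => h i, sum_rowVec ha (not_dvd_of_abs_lt (by omega) ?_)]
  rw [abs_lt]
  constructor <;> omega

theorem rowMap_injective {a : K} (ha : IsPrimitiveRoot a n) (hn : (n : K) ≠ 0)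
    (ht : 2 * t ≤ n) : Function.Injective (rowMap a n t) := by
  intro u v h
  have := congrArg (fun x => Matrix.vecMul x ((n : K)⁻¹ • (rowMatrix a⁻¹ n t).transpose)) h
  simpa [rowMap, Matrix.vecMul_vecMul, rowMatrix_mul_inv_transpose ha hn ht] using this

/-- The coefficients of the words of Piret's code. -/
theorem coeff_vecMul_piretMatrix (a : K) {w : Fin t → K[X]} {f : ℤ →₀ (Fin t → K)}
    (hneg : ∀ l < 0, f l = 0) (hf : ∀ (k : ℕ) j, f k j = (w j).coeff k) (k : ℕ) (i : Fin n) :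
    (Matrix.vecMul w (piretMatrix a n t) i).coeff k =
      encode (rowMap a n t) (rowMap a⁻¹ n t) f k i := by
  rw [encode_apply, Pi.add_apply, rowMap_apply, rowMap_apply, Matrix.vecMul, dotProduct,
    finsetSum_coeff, ← Finset.sum_add_distrib]
  refine Finset.sum_congr rfl fun j _ => ?_
  have hG : piretMatrix a n t j i = C (rowMatrix a n t j i) + C (rowMatrix a⁻¹ n t j i) * X := rfl
  rw [hG, mul_add, ← mul_assoc, coeff_add, coeff_mul_C, hf]
  congr 1
  cases k with
  | zero =>
    rw [coeff_mul_X_zero, hneg _ (by simp)]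
    simp
  | succ k =>
    rw [coeff_mul_X, coeff_mul_C, Nat.cast_succ, add_sub_cancel_right, hf]

/-- The point is that admitting inputs at negative times adds no polynomial words: a causal output
has a causal input, by injectivity of `H₀`. -/
theorem mem_rowCode_piretMatrix_iff [NeZero n] {a : K} (ha : IsPrimitiveRoot a n)
    (hn : (n : K) ≠ 0) (ht : 2 * t ≤ n) (u : Fin n → K[X]) :
    u ∈ rowCode (piretMatrix a n t) ↔
      ∃ f, interleave u = ⇑(unblock K n (encode (rowMap a n t) (rowMap a⁻¹ n t) f)) := by
  constructor
  · rintro ⟨w, rfl⟩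
    obtain ⟨f, hneg, hf⟩ := exists_seq_of_polynomials w
    refine ⟨f, funext fun N => ?_⟩
    obtain ⟨l, i, rfl⟩ := exists_eq_mul_add n N
    rw [interleave_apply, unblock_apply]
    split_ifs with hl
    · obtain ⟨k, rfl⟩ := Int.eq_ofNat_of_zero_le hl
      exact coeff_vecMul_piretMatrix a hneg hf k i
    · rw [encode_apply, hneg l (by omega), hneg (l - 1) (by omega)]
      simp
  · rintro ⟨f, hu⟩
    have key : ∀ l i, encode (rowMap a n t) (rowMap a⁻¹ n t) f l i =
        if 0 ≤ l then (u i).coeff l.toNat else 0 := fun l i => by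
      rw [← interleave_apply, hu, unblock_apply]
    have hneg : ∀ l < 0, f l = 0 :=
      eq_zero_of_encode_eq_zero_left (rowMap_injective ha hn ht) (H₁ := rowMap a⁻¹ n t)
        fun l hl => funext fun i => by rw [key, if_neg (by omega)]; rfl
    obtain ⟨w, hw⟩ := exists_polynomials_of_seq f hneg
    refine ⟨w, funext fun i => Polynomial.ext fun k => ?_⟩
    dsimp only
    rw [coeff_vecMul_piretMatrix a hneg hw, key, if_pos (by positivity), Int.toNat_natCast]

/-- The constant matrix `n⁻¹ H₁ᵀ` is a right inverse, because `H₀ H₁ᵀ = n` and `H₁ H₁ᵀ = 0`. All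
rows have degree `1`, and the coefficient of `D^t` in a maximal minor is the corresponding minor of
`H₁`. -/
theorem isConvCode_piretMatrix {a : K} (ha : IsPrimitiveRoot a n)
    (hn : (n : K) ≠ 0) (ht : 4 * t ≤ n) :
    IsConvCode (rowCode (piretMatrix a n t)) t t := by
  have hn0 : n ≠ 0 := by rintro rfl; exact hn Nat.cast_zero
  have ha0 : a ≠ 0 := ha.ne_zero hn0
  have hG : ∀ j i, piretMatrix a n t j i =
      C (rowMatrix a⁻¹ n t j i) * X + C (rowMatrix a n t j i) := fun j i => add_comm _ _
  refine ⟨_, ⟨((n : K)⁻¹ • (rowMatrix a⁻¹ n t).transpose).map C, ?_⟩, rfl, ?_, ?_, ?_⟩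
  · rw [piretMatrix_eq, Matrix.add_mul, Matrix.smul_mul, ← Matrix.map_mul, ← Matrix.map_mul,
      rowMatrix_mul_inv_transpose ha hn (by omega), Matrix.mul_smul,
      rowMatrix_mul_transpose ha.inv hn ht, smul_zero]
    simp
  · have hsup : ∀ j : Fin t, (Finset.univ.sup fun i => (piretMatrix a n t j i).natDegree) = 1 := by
      intro j
      have hdeg : ∀ i, (piretMatrix a n t j i).natDegree = 1 := fun i => by
        rw [hG]
        exact natDegree_linear (pow_ne_zero _ (inv_ne_zero ha0))
      have : Nonempty (Fin n) := ⟨⟨0, Nat.pos_of_ne_zero hn0⟩⟩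
      simp only [hdeg]
      exact Finset.sup_const Finset.univ_nonempty 1
    simp [hsup]
  · have hsub : ∀ c : Fin t → Fin n, (piretMatrix a n t).submatrix id c =
        (X : K[X]) • ((rowMatrix a⁻¹ n t).submatrix id c).map C +
          ((rowMatrix a n t).submatrix id c).map C := fun c => by
      rw [piretMatrix_eq, add_comm]; rfl
    refine ⟨Fin.castLEOrderEmb (by omega), ?_⟩
    rw [hsub]
    have hcoeff := coeff_det_X_add_C_card
      ((rowMatrix a⁻¹ n t).submatrix id (Fin.castLEOrderEmb (by omega : t ≤ n)))
      ((rowMatrix a n t).submatrix id (Fin.castLEOrderEmb (by omega : t ≤ n)))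
    have hle := natDegree_det_X_add_C_le
      ((rowMatrix a⁻¹ n t).submatrix id (Fin.castLEOrderEmb (by omega : t ≤ n)))
      ((rowMatrix a n t).submatrix id (Fin.castLEOrderEmb (by omega : t ≤ n)))
    rw [Fintype.card_fin] at hcoeff hle
    -- The first `t` columns of `H₁` form a Vandermonde matrix whose nodes are distinct, as the
    -- exponents `2j + 1` are less than `n`.
    have hvand : (rowMatrix a⁻¹ n t).submatrix id (Fin.castLEOrderEmb (by omega : t ≤ n)) =
        Matrix.vandermonde fun j : Fin t => a⁻¹ ^ (2 * (j : ℕ) + 1) := by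
      ext j i
      rw [Matrix.vandermonde_apply, ← pow_mul]
      rfl
    have hdet : ((rowMatrix a⁻¹ n t).submatrix id
        (Fin.castLEOrderEmb (by omega : t ≤ n))).det ≠ 0 := by
      rw [hvand, Matrix.det_vandermonde_ne_zero_iff]
      intro j j' h
      have h1 := j.2
      have h2 := j'.2
      have := ha.inv.pow_inj (by omega) (by omega) h
      exact Fin.ext (by omega)
    rw [← hcoeff] at hdet
    exact le_antisymm (degree_le_of_natDegree_le hle) (le_degree_of_ne_zero hdet)
  · rintro _ ⟨c, rfl⟩
    rw [piretMatrix_eq, add_comm]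
    have hle := natDegree_det_X_add_C_le
      ((rowMatrix a⁻¹ n t).submatrix id c) ((rowMatrix a n t).submatrix id c)
    rw [Fintype.card_fin] at hle
    exact degree_le_of_natDegree_le hle

end Piret

/-! ### Hermitian self-orthogonality, free distance, purity and optimality. -/

section Main

variable {F K : Type*} [Field F] [Fintype F] [Field K] [Fintype K] [Algebra F K]

attribute [local instance] fact_prime_ringChar

local notation "σ" => FiniteField.frobeniusAlgHom F K

theorem herm_unblock_single_left {n : ℕ} [NeZero n] (l : ℤ) (r : Fin n → K)
    (f : ℤ →₀ (Fin n → K)) :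
    herm F (unblock K n (Finsupp.single l r)) (unblock K n f) = ∑ i, r i * σ (f l i) := by
  rw [herm_unblock, Finsupp.sum_single_index (by simp)]

theorem card_support_unblock_single {n : ℕ} [NeZero n] (l : ℤ) (r : Fin n → K) :
    (unblock K n (Finsupp.single l r)).support.card = wt r := by
  rw [card_support_unblock, Finsupp.sum_single_index]
  simp [wt]

theorem frobenius_rowVec (a : K) (n : ℕ) (e : ℤ) (i : Fin n) :
    σ (rowVec a n e i) = rowVec (σ a) n e i := by
  rw [rowVec, rowVec, map_pow, map_zpow₀]

theorem natCast_ne_zero_of_dvd_card_sub_one {n : ℕ} (hn : n ∣ Fintype.card K - 1) :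
    (n : K) ≠ 0 := by
  intro h
  obtain ⟨m, hm⟩ := hn
  have h1 : Fintype.card K = n * m + 1 := by
    have := Fintype.card_pos (α := K)
    omega
  have h2 := congrArg (Nat.cast : ℕ → K) h1
  rw [Nat.cast_card_eq_zero, Nat.cast_add, Nat.cast_mul, h, zero_mul, zero_add, Nat.cast_one] at h2
  exact zero_ne_one h2

theorem exists_isPrimitiveRoot_of_dvd_card_sub_one {n : ℕ} (hn : n ∣ Fintype.card K - 1) :
    ∃ a : K, IsPrimitiveRoot a n := by
  classical
  obtain ⟨g, hg⟩ := IsCyclic.exists_ofOrder_eq_natCard (α := Kˣ)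
  obtain ⟨m, hm⟩ := hn
  have hcard : orderOf g = m * n := by
    rw [hg, Nat.card_eq_fintype_card, Fintype.card_units, hm, mul_comm]
  refine ⟨((g ^ m : Kˣ) : K), IsPrimitiveRoot.coe_units_iff.2 ?_⟩
  exact (IsPrimitiveRoot.orderOf g).pow (orderOf_pos g) hcard

/-- The exponents that occur in the rows of the coefficient matrices of Piret's code. -/
def rowExponents (t : ℕ) : Set ℤ := {e | ∃ j < t, e = 2 * (j : ℕ) + 1 ∨ e = -(2 * (j : ℕ) + 1)}

/-- The sum is nonzero because `|e| < q ≤ |q e'|`, and its absolute value is at most `(2t - 1)(q +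
1) < n`. -/
theorem not_dvd_rowExponents {q n t : ℕ} (h1 : 2 * t * (q + 1) ≤ n) (h2 : 2 * t < q) {e e' : ℤ}
    (he : e ∈ rowExponents t) (he' : e' ∈ rowExponents t) : ¬ (n : ℤ) ∣ e + q * e' := by
  obtain ⟨j, hj, he⟩ := he
  obtain ⟨j', hj', he'⟩ := he'
  have hP1 : (q : ℤ) ≤ q * (2 * (j' : ℕ) + 1) := le_mul_of_one_le_right (by omega) (by omega)
  have hP2 : (q : ℤ) * (2 * (j' : ℕ) + 1) ≤ q * (2 * t - 1) :=
    mul_le_mul_of_nonneg_left (by omega) (by omega)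
  have hn : (q : ℤ) * (2 * t - 1) + q + 2 * t ≤ n := by
    have : ((2 * t * (q + 1) : ℕ) : ℤ) ≤ n := by exact_mod_cast h1
    push_cast at this
    linarith
  have he'' : (q : ℤ) * e' = q * (2 * (j' : ℕ) + 1) ∨ (q : ℤ) * e' = -(q * (2 * (j' : ℕ) + 1)) := by
    rcases he' with rfl | rfl
    · exact Or.inl rfl
    · exact Or.inr (by ring)
  generalize (q : ℤ) * (2 * (j' : ℕ) + 1) = P at hP1 hP2 he''
  generalize (q : ℤ) * e' = P' at he''
  generalize (q : ℤ) * (2 * t - 1) = P'' at hP2 hn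
  refine not_dvd_of_abs_lt ?_ ?_
  · omega
  · rw [abs_lt]
    constructor <;> omega

theorem not_dvd_of_mem_rowExponents {n t : ℕ} (h : 2 * t ≤ n) {e : ℤ} (he : e ∈ rowExponents t) :
    ¬ (n : ℤ) ∣ e := by
  obtain ⟨j, hj, he⟩ := he
  refine not_dvd_of_abs_lt (by omega) ?_
  rw [abs_lt]
  constructor <;> omega

variable {n t : ℕ}

/-- The span of the rows of the coefficient matrices of Piret's code. -/
def rowSpan (a : K) (n t : ℕ) : Submodule K (Fin n → K) :=
  Submodule.span K (rowVec a n '' rowExponents t)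

theorem rowMap_mem_rowSpan (a : K) (u : Fin t → K) : rowMap a n t u ∈ rowSpan a n t := by
  have : rowMap a n t u = ∑ j, u j • rowVec a n (2 * (j : ℕ) + 1) := by
    funext i
    rw [rowMap_apply, Finset.sum_apply]
    exact Finset.sum_congr rfl fun j _ => by rw [rowMatrix_apply]; rfl
  rw [this]
  exact Submodule.sum_mem _ fun j _ => Submodule.smul_mem _ _
    (Submodule.subset_span ⟨_, ⟨j, j.2, Or.inl rfl⟩, rfl⟩)

theorem rowMap_inv_mem_rowSpan (a : K) (u : Fin t → K) : rowMap a⁻¹ n t u ∈ rowSpan a n t := by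
  have : rowMap a⁻¹ n t u = ∑ j, u j • rowVec a n (-(2 * (j : ℕ) + 1)) := by
    funext i
    rw [rowMap_apply, Finset.sum_apply]
    exact Finset.sum_congr rfl fun j _ => by rw [rowMatrix_inv_apply]; rfl
  rw [this]
  exact Submodule.sum_mem _ fun j _ => Submodule.smul_mem _ _
    (Submodule.subset_span ⟨_, ⟨j, j.2, Or.inr rfl⟩, rfl⟩)

theorem sum_eq_zero_of_mem_rowSpan {a : K} (ha : IsPrimitiveRoot a n) (h : 2 * t ≤ n)
    {r : Fin n → K} (hr : r ∈ rowSpan a n t) : ∑ i, r i = 0 := by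
  induction hr using Submodule.span_induction with
  | mem r hr =>
    obtain ⟨e, he, rfl⟩ := hr
    exact sum_rowVec ha (not_dvd_of_mem_rowExponents h he)
  | zero => simp
  | add r r' _ _ hr hr' => simp [Finset.sum_add_distrib, hr, hr']
  | smul x r _ hr => simp [← Finset.mul_sum, hr]

/-- The rows of the coefficient matrices of Piret's code are Hermitian orthogonal. -/
theorem herm_eq_zero_of_mem_rowSpan [NeZero n] {a : K} (ha : IsPrimitiveRoot a n)
    (h1 : 2 * t * (Fintype.card F + 1) ≤ n) (h2 : 2 * t < Fintype.card F)
    {r r' : Fin n → K} (hr : r ∈ rowSpan a n t) (hr' : r' ∈ rowSpan a n t) :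
    ∑ i, r i * σ (r' i) = 0 := by
  have ha0 : a ≠ 0 := ha.ne_zero (NeZero.ne n)
  induction hr using Submodule.span_induction with
  | mem r hr =>
    obtain ⟨e, he, rfl⟩ := hr
    induction hr' using Submodule.span_induction with
    | mem r' hr' =>
      obtain ⟨e', he', rfl⟩ := hr'
      rw [← sum_rowVec ha (not_dvd_rowExponents h1 h2 he he')]
      refine Finset.sum_congr rfl fun i _ => ?_
      rw [← rowVec_mul ha0]
      congr 1
      rw [frobenius_rowVec, rowVec, rowVec, zpow_mul, zpow_natCast]
      rfl
    | zero => simp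
    | add r r' _ _ hr hr' =>
      simp only [Pi.add_apply, map_add, mul_add, Finset.sum_add_distrib, hr, hr', add_zero]
    | smul x r _ hr =>
      rw [← mul_zero (σ x), ← hr, Finset.mul_sum]
      refine Finset.sum_congr rfl fun i _ => ?_
      rw [Pi.smul_apply, smul_eq_mul, map_mul]
      ring
  | zero => simp
  | add r r' _ _ hr hr' =>
    simp only [Pi.add_apply, add_mul, Finset.sum_add_distrib, hr, hr', add_zero]
  | smul x r _ hr =>
    simp only [Pi.smul_apply, smul_eq_mul, mul_assoc, ← Finset.mul_sum, hr, mul_zero]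

/-- Piret's codes define convolutional stabilizer codes with free distance `2 * t + 1`. -/
theorem exists_piret_convStabCode [NeZero n] (hK : Fintype.card K = Fintype.card F ^ 2) {β : K}
    (hβ : LinearIndependent F ![β, σ β]) (hodd : Odd n) (hnK : (n : K) ≠ 0)
    (h1 : 2 * t * (Fintype.card F + 1) ≤ n) (h2 : 2 * t < Fintype.card F) (ht : 0 < t)
    {a : K} (ha : IsPrimitiveRoot a n) :
    ∃ Q : ConvStabCode F n (n - 2 * t) n,
      Q.IsPureLinear β t (2 * t + 1) ∧ Q.classicalCode β = rowCode (piretMatrix a n t) := by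
  have h4 : 4 * t ≤ n := by
    have := Nat.mul_le_mul_left (2 * t) (show 2 ≤ Fintype.card F + 1 by omega)
    omega
  have hlt : 2 * t < n := by omega
  -- The Hermitian form conjugates its second argument, so the dual words are orthogonal to rows in
  -- powers of `a^q`.
  have ha' : IsPrimitiveRoot (σ a) n := ha.map_of_injective (σ).injective
  set H₀ := rowMap a n t with hH₀
  set H₁ := rowMap a⁻¹ n t with hH₁
  have hinj₀ : Function.Injective H₀ := rowMap_injective ha hnK hlt.le
  have hinj₁ : Function.Injective H₁ := rowMap_injective ha.inv hnK hlt.le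
  obtain ⟨Q, Φ, hΦ, hS₀, hS⟩ := exists_convStabCode hK hβ (H₁ := H₁) hinj₀ (rowSpan a n t)
    (rowMap_mem_rowSpan a) (rowMap_inv_mem_rowSpan a)
    (fun r hr r' hr' => herm_eq_zero_of_mem_rowSpan ha h1 h2 hr hr')
    (fun r hr => sum_eq_zero_of_mem_rowSpan ha hlt.le hr) hlt.le
  have hzero : ∀ u, codeSymbol hK hβ H₀ H₁ u = 0 → u = 0 := fun u hu =>
    (map_eq_zero_iff _ (codeSymbol_injective hK hβ H₁ hinj₀)).1 hu
  -- the minimum distance of the dual code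
  have hdist : ∀ (c : ZMod (ringChar F)) (w : Symbol F),
      pauliOp c w ∈ Subgroup.centralizer (Q.stabilizer : Set (Op F)) → w ≠ 0 →
      2 * t + 1 ≤ (tauSeq β w).support.card := by
    intro c w hc hw
    obtain ⟨f, hf⟩ := (unblock K n).surjective (tauSeq β w)
    have hf0 : f ≠ 0 := by
      rintro rfl
      rw [map_zero] at hf
      exact hw ((map_eq_zero_iff _ (tauSeq_injective hβ)).1 hf.symm)
    rw [← hf]
    refine le_card_support_of_orthogonal ha' hodd hf0 fun l j hj => ?_
    have horth : herm F (tauSeq β w)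
        (unblock K n (encode H₀ H₁ (Finsupp.single l (Pi.single ⟨j, hj⟩ 1)))) = 0 := by
      refine herm_eq_zero_of_phaseForm_comm hK hβ fun x w' hw' => ?_
      rw [← map_smul, ← map_smul, ← tauSeq_codeSymbol hK hβ] at hw'
      rw [tauSeq_injective hβ hw']
      obtain ⟨d, hd⟩ := hΦ (x • Finsupp.single l (Pi.single ⟨j, hj⟩ 1))
      have := Subgroup.mem_centralizer_iff.1 hc _ ((hS _).2 ⟨_, hd.symm⟩)
      exact (pauliOp_mul_comm_iff.1 this).symm
    rw [← hf, encode_single, map_add, herm_add_right, herm_unblock_single,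
      herm_unblock_single] at horth
    rw [← horth]
    congr 1
    · refine Finset.sum_congr rfl fun i _ => ?_
      rw [← frobenius_rowVec, hH₀, rowMap, Matrix.vecMulLinear_apply, Matrix.single_one_vecMul,
        Matrix.row_apply, rowMatrix_apply]
    · refine Finset.sum_congr rfl fun i _ => ?_
      rw [← frobenius_rowVec, hH₁, rowMap, Matrix.vecMulLinear_apply, Matrix.single_one_vecMul,
        Matrix.row_apply, rowMatrix_inv_apply]
  have hclass : Q.classicalCode β = rowCode (piretMatrix a n t) := by
    ext u
    rw [mem_rowCode_piretMatrix_iff ha hnK hlt.le]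
    constructor
    · rintro ⟨g, hg, hu⟩
      obtain ⟨f, rfl⟩ := (hS g).1 hg
      obtain ⟨c, w, hw, hv⟩ := isTau_iff.1 hu
      obtain ⟨d, hd⟩ := hΦ f
      refine ⟨f, ?_⟩
      rw [hv, ← (pauliOp_injective (hd.symm.trans hw)).2, tauSeq_codeSymbol]
    · rintro ⟨f, hf⟩
      obtain ⟨d, hd⟩ := hΦ f
      exact ⟨_, (hS _).2 ⟨f, rfl⟩, isTau_iff.2 ⟨d, _, hd, by rw [hf, tauSeq_codeSymbol]⟩⟩
  refine ⟨Q, ⟨?_, ⟨t, by omega, ?_⟩, ⟨?_, ?_⟩, ?_⟩, hclass⟩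
  · intro g hg v hv x
    obtain ⟨u, rfl⟩ := (hS₀ g).1 hg
    obtain ⟨c, w, hw, rfl⟩ := isTau_iff.1 hv
    obtain ⟨d, hd⟩ := hΦ (Finsupp.single 0 u)
    obtain ⟨d', hd'⟩ := hΦ (Finsupp.single 0 (x • u))
    refine ⟨_, (hS₀ _).2 ⟨x • u, rfl⟩, isTau_iff.2 ⟨d', _, hd', ?_⟩⟩
    rw [← (pauliOp_injective (hd.symm.trans hw)).2, tauSeq_codeSymbol, tauSeq_codeSymbol,
      ← Finsupp.smul_single, map_smul, map_smul, Finsupp.coe_smul]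
  · rw [hclass]
    exact isConvCode_piretMatrix ha hnK h4
  -- To attain the distance, take one block orthogonal to the conjugates of all `2t` rows of `H₀`
  -- and `H₁`. It is then orthogonal to every block of every code sequence.
  · obtain ⟨r, hr0, hr, hrwt⟩ := exists_wt_le (ι := Fin t ⊕ Fin t)
      (Sum.elim (fun j i => σ (rowMatrix a n t j i)) fun j i => σ (rowMatrix a⁻¹ n t j i))
      (by rw [Fintype.card_sum, Fintype.card_fin]; omega)
    rw [Fintype.card_sum, Fintype.card_fin] at hrwt
    obtain ⟨w, hw⟩ := tauSeq_surjective hK hβ (unblock K n (Finsupp.single 0 r))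
    have horth : ∀ (M : Matrix (Fin t) (Fin n) K) (u : Fin t → K),
        (∀ j, ∑ i, σ (M j i) * r i = 0) → ∑ i, r i * σ (∑ j, u j * M j i) = 0 := by
      intro M u hM
      simp only [map_sum, Finset.mul_sum]
      rw [Finset.sum_comm]
      refine Finset.sum_eq_zero fun j _ => ?_
      rw [← mul_zero (σ (u j)), ← hM j, Finset.mul_sum]
      refine Finset.sum_congr rfl fun i _ => ?_
      rw [map_mul]
      ring
    have hw0 : w ≠ 0 := by
      rintro rfl
      rw [map_zero, eq_comm, map_eq_zero_iff _ (unblock K n).injective,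
        Finsupp.single_eq_zero] at hw
      exact hr0 hw
    have hcent : pauliOp 0 w ∈ Subgroup.centralizer (Q.stabilizer : Set (Op F)) := by
      rw [Subgroup.mem_centralizer_iff]
      intro g hg
      obtain ⟨u, rfl⟩ := (hS g).1 hg
      obtain ⟨d, hd⟩ := hΦ u
      rw [hd, pauliOp_mul_comm_iff]
      refine (phaseForm_comm_of_herm_eq_zero hK hβ ?_).symm
      rw [hw, tauSeq_codeSymbol, herm_unblock_single_left]
      simp only [encode_apply, Pi.add_apply, map_add, mul_add, Finset.sum_add_distrib]
      have e₀ := horth (rowMatrix a n t) (u 0) fun j => hr (Sum.inl j)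
      have e₁ := horth (rowMatrix a⁻¹ n t) (u (0 - 1)) fun j => hr (Sum.inr j)
      exact (congrArg₂ (· + ·) e₀ e₁).trans (add_zero 0)
    refine ⟨pauliOp 0 w, pauliOp_mem_pauliInf _ _, hcent, fun hmem => ?_, ?_⟩
    · obtain ⟨c', hc'⟩ := exists_mem_of_mem_centerOf_sup hmem
      obtain ⟨u, hu⟩ := (hS _).1 hc'
      obtain ⟨d, hd⟩ := hΦ u
      have hwu := (pauliOp_injective (hu.trans hd)).2
      have hblocks : encode H₀ H₁ u = Finsupp.single 0 r := by
        apply (unblock K n).injective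
        rw [← tauSeq_codeSymbol hK hβ, ← hwu, hw]
      -- No nonzero code sequence is confined to block `0`: nothing before it forces the inputs at
      -- negative times to vanish, and nothing after it forces the others to vanish.
      have hu0 : u = 0 := by
        ext1 l
        rcases lt_or_ge l 0 with hl | hl
        · exact eq_zero_of_encode_eq_zero_left hinj₀ (H₁ := H₁) (A := 0)
            (fun l hl => by rw [hblocks, Finsupp.single_eq_of_ne (by omega)]) l hl
        · exact eq_zero_of_encode_eq_zero_right hinj₁ (H₀ := H₀) (A := 0)
            (fun l hl => by rw [hblocks, Finsupp.single_eq_of_ne (by omega)]) l hl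
      rw [hu0, map_zero] at hwu
      exact hw0 hwu
    · rw [hasWeight_pauliOp_iff hβ]
      refine le_antisymm ?_ (hdist 0 w hcent hw0)
      rw [hw, card_support_unblock_single]
      omega
  · rintro d ⟨e, he, hc, hnot, hd⟩
    obtain ⟨c, w, -, rfl⟩ := pauliGroup_le _ he
    rw [hasWeight_pauliOp_iff hβ] at hd
    rw [← hd]
    refine hdist c w hc ?_
    rintro rfl
    refine hnot (Subgroup.mem_sup_left ⟨he, Subgroup.mem_centralizer_iff.2 fun g hg => ?_⟩)
    obtain ⟨c', w', -, rfl⟩ := pauliGroup_le _ hg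
    rw [pauliOp_mul_comm_iff, phaseForm_zero_left, phaseForm_zero_right]
  · intro g hg hg1 d hd
    obtain ⟨u, rfl⟩ := (hS g).1 hg
    obtain ⟨c, hc⟩ := hΦ u
    rw [hc, hasWeight_pauliOp_iff hβ] at hd
    rw [← hd]
    refine hdist c _ ?_ ?_
    · rw [← hc, Subgroup.mem_centralizer_iff]
      intro h hh
      obtain ⟨v, rfl⟩ := (hS h).1 hh
      rw [← toMul_add, ← toMul_add, ← map_add, ← map_add, add_comm]
    · intro h0
      rw [hzero u h0, map_zero, toMul_zero] at hg1
      exact hg1 rfl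

/-- Pure linear codes of degree `δ` with `n - k = 2 * r` have free distance at most
`r + δ + 1`. -/
theorem le_of_isPureLinear [NeZero n] (hK : Fintype.card K = Fintype.card F ^ 2) {β : K}
    (hβ : LinearIndependent F ![β, σ β]) {k m r δ d : ℕ} (hr : 2 * r + k = n) (hlt : r + δ < n)
    (Q : ConvStabCode F n k m) (hQ : Q.IsPureLinear β δ d) : d ≤ r + δ + 1 := by
  obtain ⟨-, ⟨r', hr', G, -, hG, hdeg, -⟩, hfree, hpure⟩ := hQ
  obtain rfl : r' = r := by omega
  -- One condition for each coefficient of each row of `G`: row `j` of degree `ν j` has `ν j + 1`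
  -- coefficient vectors, which makes `r + δ` conditions.
  obtain ⟨v, hv0, hv, hvwt⟩ := exists_wt_le
    (ι := Σ j : Fin r', Fin ((Finset.univ.sup fun i => (G j i).natDegree) + 1))
    (fun x i => σ ((G x.1 i).coeff x.2)) (by
      simp only [Fintype.card_sigma, Fintype.card_fin, Finset.sum_add_distrib, hdeg,
        Finset.sum_const, Finset.card_univ, smul_eq_mul, mul_one]
      omega)
  simp only [Fintype.card_sigma, Fintype.card_fin, Finset.sum_add_distrib, hdeg,
    Finset.sum_const, Finset.card_univ, smul_eq_mul, mul_one] at hvwt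
  have hcoeff : ∀ j b, ∑ i, σ ((G j i).coeff b) * v i = 0 := by
    intro j b
    by_cases hb : b < (Finset.univ.sup fun i => (G j i).natDegree) + 1
    · exact hv ⟨j, ⟨b, hb⟩⟩
    · refine Finset.sum_eq_zero fun i _ => ?_
      have : (G j i).natDegree ≤ Finset.univ.sup fun i => (G j i).natDegree :=
        Finset.le_sup (f := fun i => (G j i).natDegree) (Finset.mem_univ i)
      rw [coeff_eq_zero_of_natDegree_lt (by omega), map_zero, zero_mul]
  obtain ⟨w, hw⟩ := tauSeq_surjective hK hβ (unblock K n (Finsupp.single 0 v))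
  have hw0 : w ≠ 0 := by
    rintro rfl
    rw [map_zero, eq_comm, map_eq_zero_iff _ (unblock K n).injective,
      Finsupp.single_eq_zero] at hw
    exact hv0 hw
  have hcent : pauliOp 0 w ∈ Subgroup.centralizer (Q.stabilizer : Set (Op F)) := by
    suffices hle : Q.stabilizer ≤ Subgroup.centralizer {pauliOp 0 w} by
      rw [Subgroup.mem_centralizer_iff]
      exact fun g hg => (Subgroup.mem_centralizer_iff.1 (hle hg) _ rfl).symm
    refine iSup_le fun l => ?_
    rintro _ ⟨M, hM, rfl⟩
    obtain ⟨c, w₀, hw₀, rfl⟩ := pauliGroup_le _ (Q.le_pauli hM)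
    rw [Subgroup.mem_centralizer_iff]
    rintro _ rfl
    rw [shift_pauliOp, pauliOp_mul_comm_iff]
    refine phaseForm_comm_of_herm_eq_zero hK hβ ?_
    obtain ⟨f, hf⟩ := (unblock K n).surjective (tauSeq β w₀)
    rw [hw, tauSeq_translateSymbol, ← hf, translateSeq_unblock, herm_unblock_single_left]
    simp only [translateSeq_apply, zero_sub]
    -- Elements of `S_0` act on no qudits with negative index, so their sequences come from
    -- polynomial tuples and belong to the classical code.
    have hneg : ∀ l < 0, f l = 0 := by
      intro l hl
      funext i
      rw [← unblock_apply, hf]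
      by_contra hne
      have hsupp := hw₀ (l * n + i) (by
        have hi := i.2
        have : l * n ≤ -1 * n := mul_le_mul_of_nonneg_right (by omega) (by positivity)
        rw [Set.mem_Ico]
        omega)
      rcases (tauSeq_ne_zero_iff hβ _ _).1 hne with h | h
      · exact h hsupp.1
      · exact h hsupp.2
    obtain ⟨u, hu⟩ := exists_polynomials_of_seq f hneg
    have hmem : u ∈ Q.classicalCode β := by
      refine ⟨pauliOp c w₀, Subgroup.mem_iSup_of_mem 0 ⟨_, hM, ?_⟩, isTau_iff.2 ⟨c, w₀, rfl, ?_⟩⟩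
      · rw [zero_mul, shift_pauliOp]
        congr 1
        refine Prod.ext (Finsupp.ext fun i => ?_) (Finsupp.ext fun i => ?_)
        · exact congrArg w₀.1 (sub_zero i)
        · exact congrArg w₀.2 (sub_zero i)
      · rw [← hf]
        funext N
        obtain ⟨l, i, rfl⟩ := exists_eq_mul_add n N
        rw [interleave_apply, unblock_apply]
        split_ifs with hl
        · obtain ⟨k, rfl⟩ := Int.eq_ofNat_of_zero_le hl
          exact (hu k i).symm
        · rw [hneg l (by omega)]; rfl
    rw [hG] at hmem
    obtain ⟨x, rfl⟩ := hmem
    -- Shifting by `l` blocks brings block `-l` of the code word onto block `0`, where `v` lives.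
    -- That block is zero or a combination of coefficient vectors of rows of `G`.
    rcases lt_or_ge (-l) 0 with hl | hl
    · simp [hneg _ hl]
    · obtain ⟨k, hk⟩ := Int.eq_ofNat_of_zero_le hl
      rw [hk]
      simp only [hu, Matrix.vecMul, dotProduct, finsetSum_coeff, coeff_mul, map_sum,
        Finset.mul_sum]
      rw [Finset.sum_comm]
      refine Finset.sum_eq_zero fun j _ => ?_
      rw [Finset.sum_comm]
      refine Finset.sum_eq_zero fun p _ => ?_
      rw [← mul_zero (σ ((x j).coeff p.1)), ← hcoeff j p.2, Finset.mul_sum]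
      refine Finset.sum_congr rfl fun i _ => ?_
      rw [map_mul]
      ring
  have hweight : HasWeight (pauliOp 0 w) (wt v) := by
    rw [hasWeight_pauliOp_iff hβ, hw, card_support_unblock_single]
  refine le_trans ?_ (hvwt.trans (by omega))
  by_cases hmem : pauliOp 0 w ∈ centerOf (pauliInf F) ⊔ Q.stabilizer
  · obtain ⟨c', hc'⟩ := exists_mem_of_mem_centerOf_sup hmem
    refine hpure _ hc' (fun h => hw0 ?_) _ ?_
    · exact (pauliOp_injective (h.trans pauliOp_zero.symm)).2
    · rw [hasWeight_pauliOp_iff hβ, hw, card_support_unblock_single]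
  · exact hfree.2 ⟨_, pauliOp_mem_pauliInf _ _, hcent, hmem, hweight⟩

/-- Since `2t < 2n - 2t`, the floor is zero and the bound reduces to `t + t + 1`. -/
theorem singletonBound_eq {n t : ℕ} (ht : 0 < t) (h : 4 * t ≤ n) :
    singletonBound n (n - 2 * t) t = 2 * t + 1 := by
  have hn : (4 * t : ℚ) ≤ n := by exact_mod_cast h
  have ht' : (0 : ℚ) < t := by exact_mod_cast ht
  have hfloor : ⌊(2 * t : ℚ) / ((n : ℚ) + (n - 2 * t : ℕ))⌋ = 0 := by
    rw [Nat.cast_sub (by omega), Int.floor_eq_zero_iff, Set.mem_Ico]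
    push_cast
    have hpos : (0 : ℚ) < n + (n - 2 * t) := by linarith
    exact ⟨by positivity, by rw [div_lt_one hpos]; linarith⟩
  rw [singletonBound, hfloor, Nat.cast_sub (by omega)]
  push_cast
  ring

end Main

end QConv
end

theorem mainTheorem2 {F K : Type*} [Field F] [Fintype F] [Field K] [Fintype K] [Algebra F K]
    (q n μ t : ℕ) (hF : Fintype.card F = q) (hK : Fintype.card K = q ^ 2)
    (β : K) (hβ : LinearIndependent F ![β, β ^ q])
    (hn_odd : Odd n) (hn_dvd : n ∣ q ^ 2 - 1) (hn_gt : q + 1 < n) (hn_le : n ≤ q ^ 2 - 1)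
    (hμt : μ = 2 * t) (hμ_ge : 2 ≤ μ) (hμ_le : μ ≤ n / (q + 1)) :
    (∃ α : K, IsPrimitiveRoot α n) ∧
    (∀ α : K, IsPrimitiveRoot α n →
      ∃ Q : QConv.ConvStabCode F n (n - μ) n,
        Q.IsPureLinear β (μ / 2) (μ + 1) ∧
        Q.classicalCode β = QConv.rowCode (QConv.piretMatrix α n t)) ∧
    ((μ + 1 : ℕ) : ℚ) = QConv.singletonBound n (n - μ) (μ / 2) ∧
    (∀ (m d : ℕ) (Q : QConv.ConvStabCode F n (n - μ) m),
      Q.IsPureLinear β (μ / 2) d → d ≤ μ + 1) := by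
  subst hF hμt
  have hdiv : 2 * t * (Fintype.card F + 1) ≤ n := (Nat.le_div_iff_mul_le (by omega)).1 hμ_le
  -- If `μ ≥ q`, then `n ≥ μ (q + 1) ≥ q² + q`, contrary to `n ≤ q² - 1`.
  have hlt : 2 * t < Fintype.card F := by
    by_contra! h
    have h1 : Fintype.card F * (Fintype.card F + 1) ≤ 2 * t * (Fintype.card F + 1) :=
      Nat.mul_le_mul_right _ h
    have h2 : Fintype.card F * (Fintype.card F + 1) = Fintype.card F ^ 2 + Fintype.card F := by ring
    omega
  have h4 : 4 * t ≤ n := by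
    have := Nat.mul_le_mul_left (2 * t) (show 2 ≤ Fintype.card F + 1 by omega)
    omega
  have : NeZero n := ⟨by omega⟩
  have hhalf : 2 * t / 2 = t := by omega
  rw [← hK] at hn_dvd
  rw [hhalf]
  refine ⟨QConv.exists_isPrimitiveRoot_of_dvd_card_sub_one hn_dvd, fun α hα =>
    QConv.exists_piret_convStabCode hK hβ hn_odd
      (QConv.natCast_ne_zero_of_dvd_card_sub_one hn_dvd) hdiv hlt (by omega) hα, ?_,
    fun m d Q hQ => ?_⟩
  · rw [QConv.singletonBound_eq (by omega) h4]
    push_cast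
    rfl
  · have := QConv.le_of_isPureLinear hK hβ (r := t) (by omega) (by omega) Q hQ
    omega
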